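/- Variables are named by binary words. A literal is a variable $x$ (positive) or its negation $\neg x$ (negative), a clause is a finite set of literals, and a CNF formula is a finite set of clauses. A CNF default theory $T=\langle W,D\rangle$ consists of a finite set $W$ of CNF formulas and a finite set $D=\{\delta_1,\dots,\delta_n\}$ of default rules $\delta_i=\frac{\alpha:\beta}{\gamma}$ with CNF formulas $\alpha,\beta,\gamma$. It is a $\Theta$ default theory, for a class $\Theta$ of CNF formulas, if all formulas occurring in it belong to $\Theta$. The target classes are: $\mathrm{Horn}$ (every clause has at most one positive literal), $\mathrm{ID}$ (every clause has at most one literal, and only a positive one), $\mathrm{Krom}$ (every clause has at most two literals), and $\mathrm{Monotone}$ (all literals are positive). An extended literal is a literal $\ell$ or a symbol $x_\varepsilon$ for a variable $x$. The reduct of a formula with respect to a literal $\ell$ is obtained by deleting all clauses containing $\ell$ and deleting the complement of $\ell$ from the remaining clauses; the reduct with respect to $x_\varepsilon$ is obtained by deleting $x$ and $\neg x$ from all clauses. The reduct of a theory $\langle W,D\rangle$ replaces $W$ by the union of the reducts of its formulas, and replaces $\alpha,\beta,\gamma$ in each rule $\delta_i$ by their reducts, adding to the reduct of $\gamma$ the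 unit clause $\{y_i\}$, where $y_i$ is a fresh variable. A set $B$ of variables of $T$ is a strong $\Theta$-backdoor of $T$ if, for every set $Y$ that contains exactly one of $x,\neg x,x_\varepsilon$ for each $x\in B$ and nothing else, the theory obtained from $T$ by taking the reducts with respect to the elements of $Y$ one after the other is a $\Theta$ default theory. A parameterised problem $L\subseteq\Sigma^*\times\mathbb N$ is in $\mathrm{FPT}=\mathrm{para\text{-}P}$ if there are a finite alphabet $\Sigma'$, a computable function $f:\mathbb N\to\Sigma'^*$ and a polynomial-time decidable problem $L'\subseteq\Sigma^*\times\Sigma'^*$ such that $(x,k)\in L\iff(x,f(k))\in L'$ for all $x$ and $k$. **Theorem.** (1) For every $\mathcal C\in\{\mathrm{Horn},\mathrm{ID},\mathrm{Krom},\mathrm{Monotone}\}$, the problem of deciding, given a CNF default theory $T$ and $k\in\mathbb N$, whether $T$ has a strong $\mathcal C$-backdoor of size at most $k$, parameterised by $k$, is in $\mathrm{FPT}$. (2) Let $T$ be a CNF default theory and $B$ a set of variables of $T$. - $B$ is a strong $\mathrm{Horn}$-backdoor of $T$ if and only if $B$ is a vertex cover of the graph on the variables in which two distinct variables $x,y$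 are adjacent when some clause of a formula of $T$ contains both positive literals $x$ and $y$. - $B$ is a strong $\mathrm{ID}$-backdoor of $T$ if and only if $B$ is a vertex cover of the graph in which two distinct variables are adjacent when both occur (positively or negatively) in a common clause of a formula of $T$, and in addition $B$ contains every variable $x$ for which $\neg x$ occurs in $T$ (that is, if and only if $B$ is a vertex cover of this graph with loops added at these variables $x$). - If no clause of $T$ contains a literal together with its complement, then $B$ is a strong $\mathrm{Krom}$-backdoor of $T$ if and only if $B$ meets every hyperedge of the hypergraph whose hyperedges are the sets of three distinct variables occurring in a common clause of a formula of $T$. - $B$ is a strong $\mathrm{Monotone}$-backdoor of $T$ if and only if $B$ contains every variable $x$ for which $\neg x$ occurs in $T$. -/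

import Mathlib

namespace DefaultLogic

/-! ### Parameterised complexity -/

/-- `S ∈ P`, where the elements of `α` are written as words by the encoding `e` over a finite
alphabet: some (finite, multi-stack) Turing machine decides membership in `S` within a number of
steps that is polynomial in the length of the input word. -/
def InP {α Γ : Type} [Fintype Γ] (e : Computability.Encoding α Γ) (S : Set α) : Prop :=
  ∃ χ : α → Bool, (∀ a, χ a = true ↔ a ∈ S) ∧
    Nonempty (Turing.TM2ComputableInPolyTime e.encode Computability.encodeBool χ)

/-- A parameterised problem `L ⊆ Σ* × ℕ` is in `FPT = para-P` if there are a finite alphabet `Σ'`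
(without loss of generality `Fin m`), a computable `f : ℕ → Σ'*` and a problem
`L' ⊆ Σ* × Σ'*` in `P` such that `(x, k) ∈ L ↔ (x, f k) ∈ L'` for all `(x, k)`. -/
def FPT {A : Type} [Fintype A] (L : Set (List A × ℕ)) : Prop :=
  ∃ (m : ℕ) (f : ℕ → List (Fin m)) (L' : Set (List A × List (Fin m))),
    Computable f ∧
    InP (Computability.encodingProd (Computability.encodingList A)
      (Computability.encodingList (Fin m))) L' ∧
    ∀ (x : List A) (k : ℕ), (x, k) ∈ L ↔ (x, f k) ∈ L'

/-! ### Propositional formulas in conjunctive normal form -/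

/-- A propositional variable, identified with its name, a binary word. -/
abbrev Var := List Bool

/-- The literal `x` (if `pos = true`) or `¬ x` (if `pos = false`), for `x = var`. -/
structure Lit where
  var : Var
  pos : Bool
  deriving DecidableEq

/-- The complementary literal. -/
def Lit.neg (l : Lit) : Lit := ⟨l.var, !l.pos⟩

/-- A clause is a finite set of literals (their disjunction). -/
abbrev Clause := Finset Lit

/-- A formula in conjunctive normal form is a finite set of clauses (their conjunction). -/
abbrev CNF := Finset Clause

/-- The set of variables occurring in a formula. -/
def CNF.vars (φ : CNF) : Finset Var := φ.biUnion fun C => C.image Lit.var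

/-- Every clause contains at most one positive literal. -/
def Horn : Set CNF := {φ | ∀ C ∈ φ, (C.filter fun l => l.pos = true).card ≤ 1}

/-- Every clause contains at most two literals. -/
def Krom : Set CNF := {φ | ∀ C ∈ φ, C.card ≤ 2}

/-- Every clause contains only positive literals. -/
def Monotone : Set CNF := {φ | ∀ C ∈ φ, ∀ l ∈ C, l.pos = true}

/-- Positive unit formulas: every clause contains at most one literal, and only a positive one.
(As for the other classes, the empty clause is allowed, so that the class is closed under
subformulas.) -/
def PosUnit : Set CNF := {φ | ∀ C ∈ φ, C.card ≤ 1 ∧ ∀ l ∈ C, l.pos = true}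

/-! ### Default theories -/

/-- The default rule `prereq : just / concl`. -/
structure DefaultRule where
  prereq : CNF
  just : CNF
  concl : CNF

/-- A CNF default theory `⟨W, D⟩`. The finite set `D = {δ₀, δ₁, …}` of default rules is given by an
enumeration, since the reduct refers to the index `i` of the rule `δᵢ`. -/
structure DefaultTheory where
  W : Finset CNF
  D : List DefaultRule

namespace DefaultTheory

/-- All formulas occurring in the theory. -/
def formulas (T : DefaultTheory) : Finset CNF :=
  T.W ∪ (T.D.flatMap fun d => [d.prereq, d.just, d.concl]).toFinset

/-- The set of variables occurring in the theory. -/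
def vars (T : DefaultTheory) : Finset Var := T.formulas.biUnion CNF.vars

/-- `T` is a `Θ`-default theory. -/
def IsIn (T : DefaultTheory) (Θ : Set CNF) : Prop :=
  (∀ φ ∈ T.W, φ ∈ Θ) ∧ ∀ d ∈ T.D, d.prereq ∈ Θ ∧ d.just ∈ Θ ∧ d.concl ∈ Θ

/-- No clause of `T` contains a literal together with its complement. -/
def TautologyFree (T : DefaultTheory) : Prop :=
  ∀ φ ∈ T.formulas, ∀ C ∈ φ, ∀ l ∈ C, l.neg ∉ C

end DefaultTheory

/-! ### Extended literals, reducts and strong backdoors -/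

/-- An extended literal: a literal, or the symbol `x_ε` for a variable `x`. -/
inductive ExtLit
  | lit (l : Lit)
  | eps (x : Var)

/-- The variable of an extended literal. -/
def ExtLit.var : ExtLit → Var
  | .lit l => l.var
  | .eps x => x

/-- The reduct of a formula: for a literal `l`, all clauses containing `l` are deleted and the
complement of `l` is deleted from all clauses; for `x_ε`, the literals `x` and `¬ x` are deleted
from all clauses. -/
def CNF.reduct (φ : CNF) : ExtLit → CNF
  | .lit l => (φ.filter fun C => l ∉ C).image fun C => C.erase l.neg
  | .eps x => φ.image fun C => C.filter fun l => l.var ≠ x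

/-- The reduct of a default theory with respect to one extended literal; the knowledge base becomes
the union of the reducts of its formulas, and the positive unit clause `yᵢ` is added to the
conclusion of the reduct of the rule `δᵢ`. -/
def DefaultTheory.reduct (y : ℕ → Var) (T : DefaultTheory) (e : ExtLit) : DefaultTheory where
  W := {T.W.biUnion fun φ => φ.reduct e}
  D := T.D.mapIdx fun i d =>
    ⟨d.prereq.reduct e, d.just.reduct e, insert {⟨y i, true⟩} (d.concl.reduct e)⟩

/-- The consecutive application of the reducts with respect to a list of extended literals. -/
def DefaultTheory.reducts (y : ℕ → Var) (T : DefaultTheory) (Y : List ExtLit) : DefaultTheory :=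
  Y.foldl (DefaultTheory.reduct y) T

/-- `Y` lists (in some order) a threefold assignment of `B`: for each `x ∈ B` it contains exactly
one of `x`, `¬ x`, `x_ε`, and nothing else. -/
def IsThreefold (B : Finset Var) (Y : List ExtLit) : Prop :=
  (Y.map ExtLit.var).Nodup ∧ (Y.map ExtLit.var).toFinset = B

/-- `B` is a strong `Θ`-backdoor of `T`: `B` is a set of variables of `T`, and, the `yᵢ` being
distinct variables that do not occur in `T`, all reducts of `T` with respect to threefold
assignments of `B` are `Θ`-default theories. -/
def IsStrongBackdoor (Θ : Set CNF) (T : DefaultTheory) (B : Finset Var) : Prop :=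
  B ⊆ T.vars ∧
  ∀ y : ℕ → Var, Function.Injective y → (∀ i, y i ∉ T.vars) →
    ∀ Y : List ExtLit, IsThreefold B Y → (T.reducts y Y).IsIn Θ

/-! ### Default theories as words, and the detection problem -/

/-- The alphabet in which default theories are written. -/
inductive Sym
  | sign (b : Bool)
  | bit (b : Bool)
  | endClause
  | endFormula
  | endW
  deriving DecidableEq, Fintype

/-- A formula, written down as a list of clauses, each of which is a list of literals. -/
abbrev CNFCode := List (List Lit)

/-- The formula that is written down. -/
def CNFCode.toCNF (c : CNFCode) : CNF := (c.map List.toFinset).toFinset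

/-- A literal is written as its sign followed by the name of its variable. -/
def litWord (l : Lit) : List Sym := .sign l.pos :: l.var.map Sym.bit

/-- A clause is written as its literals one after the other, followed by an end mark. -/
def clauseWord (c : List Lit) : List Sym := c.flatMap litWord ++ [.endClause]

/-- A formula is written as its clauses one after the other, followed by an end mark. -/
def CNFCode.word (c : CNFCode) : List Sym := c.flatMap clauseWord ++ [.endFormula]

/-- A default theory, written down as the list of the formulas in `W` and the list of the triples
(prerequisite, justification, conclusion) in `D`. -/
structure TheoryCode where
  W : List CNFCode
  D : List (CNFCode × CNFCode × CNFCode)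

/-- The default theory that is written down. -/
def TheoryCode.theory (c : TheoryCode) : DefaultTheory where
  W := (c.W.map CNFCode.toCNF).toFinset
  D := c.D.map fun r => ⟨r.1.toCNF, r.2.1.toCNF, r.2.2.toCNF⟩

/-- The word of a default theory: the formulas in `W`, an end mark, and then the default rules,
each of them as three consecutive formulas. -/
def TheoryCode.word (c : TheoryCode) : List Sym :=
  c.W.flatMap CNFCode.word ++ .endW ::
    c.D.flatMap fun r => r.1.word ++ r.2.1.word ++ r.2.2.word

/-- Backdoor detection: given a CNF default theory `T` (as a word) and `k`, the parameter, does `T`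
have a strong `Θ`-backdoor of size at most `k`? -/
def BackdoorDetection (Θ : Set CNF) : Set (List Sym × ℕ) :=
  {p | ∃ c : TheoryCode, c.word = p.1 ∧
    ∃ B : Finset Var, IsStrongBackdoor Θ c.theory B ∧ B.card ≤ p.2}

/-! ### (Hyper)graphs of a default theory -/

/-- Two distinct variables are joined if some clause contains both as positive literals. -/
def hornGraph (T : DefaultTheory) : SimpleGraph Var where
  Adj x z := x ≠ z ∧ ∃ φ ∈ T.formulas, ∃ C ∈ φ, (⟨x, true⟩ : Lit) ∈ C ∧ (⟨z, true⟩ : Lit) ∈ C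
  symm := ⟨fun _ _ ⟨h, φ, hφ, C, hC, hx, hz⟩ => ⟨h.symm, φ, hφ, C, hC, hz, hx⟩⟩
  loopless := ⟨fun _ h => h.1 rfl⟩

/-- Two distinct variables are joined if both occur in a common clause. -/
def primalGraph (T : DefaultTheory) : SimpleGraph Var where
  Adj x z := x ≠ z ∧ ∃ φ ∈ T.formulas, ∃ C ∈ φ, x ∈ C.image Lit.var ∧ z ∈ C.image Lit.var
  symm := ⟨fun _ _ ⟨h, φ, hφ, C, hC, hx, hz⟩ => ⟨h.symm, φ, hφ, C, hC, hz, hx⟩⟩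
  loopless := ⟨fun _ h => h.1 rfl⟩

/-- The 3-uniform hypergraph whose hyperedges are the sets of three distinct variables that occur
in a common clause. -/
def kromHypergraph (T : DefaultTheory) : Set (Finset Var) :=
  {e | e.card = 3 ∧ ∃ φ ∈ T.formulas, ∃ C ∈ φ, e ⊆ C.image Lit.var}

/-- `B` meets all hyperedges. -/
def IsHittingSet (E : Set (Finset Var)) (B : Finset Var) : Prop := ∀ e ∈ E, (e ∩ B).Nonempty

/-- The variables `x` such that `¬ x` occurs in some clause. -/
def negVars (T : DefaultTheory) : Set Var :=
  {x | ∃ φ ∈ T.formulas, ∃ C ∈ φ, (⟨x, false⟩ : Lit) ∈ C}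

end DefaultLogic

/-! All four classes are given clause by clause, by a condition that subclauses inherit and that
positive units satisfy. For such a class only one threefold assignment of `B` matters, the one by
the symbols `x_ε`: it deletes no clause and removes exactly the literals over `B`. Any other
assignment leaves only subclauses of these remainders and of the added units. So `B` is a strong
backdoor iff every clause of `T` becomes admissible once its literals over `B` are removed
(`isStrongBackdoor_setOf_iff`). The graph-theoretic descriptions are read off from this: an
inadmissible remainder exhibits an edge, a loop or a hyperedge that `B` misses.

For the complexity statement, each class is written as the formulas whose clauses have weight below
a threshold, a literal weighing at most 2 and the threshold being at most 3 (`exists_isWeighting`).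
A heavy clause then contains at most three distinct literals which are heavy together, and every
backdoor contains the variable of one of them. Branching over these literals gives a search tree of
depth `k` with `3 ^ k` leaves (`exists_succeeds_iff`).

The definition of `FPT` allows a precomputation on the parameter. Here `guide k` lists all paths of
that tree, and a deterministic machine that is given the theory and the guide follows one path after
the other (`search_guide`). Each symbol of the guide costs polynomial time, so the whole search is
polynomial in the joint length.

It remains to exhibit a machine. Structured programs are compiled into multi-stack machines
(`Cmd.inP_of_runsLe`), a finite automaton recognises the words of theories (`foldl_autStep_iff`),
and the search is programmed on stacks of literals with an explicit time bound
(`Cmd.exists_runsLe_search`). -/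

namespace DefaultLogic

/-! ### Strong backdoors and reducts of clauses -/

namespace DefaultTheory

/-- The clauses of the formulas of the theory. -/
def clauses (T : DefaultTheory) : Set Clause := {C | ∃ φ ∈ T.formulas, C ∈ φ}

theorem mem_formulas {T : DefaultTheory} {φ : CNF} :
    φ ∈ T.formulas ↔ φ ∈ T.W ∨ ∃ d ∈ T.D, φ = d.prereq ∨ φ = d.just ∨ φ = d.concl := by
  simp [formulas]

theorem isIn_setOf_iff {T : DefaultTheory} {Good : Clause → Prop} :
    T.IsIn {φ | ∀ C ∈ φ, Good C} ↔ ∀ C ∈ T.clauses, Good C := by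
  simp only [IsIn, clauses, mem_formulas, Set.mem_ofPred_eq]
  constructor
  · rintro ⟨h₁, h₂⟩ C ⟨φ, hφ | ⟨d, hd, rfl | rfl | rfl⟩, hC⟩
    · exact h₁ φ hφ C hC
    · exact (h₂ d hd).1 C hC
    · exact (h₂ d hd).2.1 C hC
    · exact (h₂ d hd).2.2 C hC
  · intro h
    refine ⟨fun φ hφ C hC => h C ⟨φ, .inl hφ, hC⟩, fun d hd => ⟨fun C hC => ?_, fun C hC => ?_,
      fun C hC => ?_⟩⟩
    · exact h C ⟨_, .inr ⟨d, hd, .inl rfl⟩, hC⟩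
    · exact h C ⟨_, .inr ⟨d, hd, .inr (.inl rfl)⟩, hC⟩
    · exact h C ⟨_, .inr ⟨d, hd, .inr (.inr rfl)⟩, hC⟩

theorem mem_vars_of_mem_clauses {T : DefaultTheory} {C : Clause} (hC : C ∈ T.clauses) {l : Lit}
    (hl : l ∈ C) : l.var ∈ T.vars := by
  obtain ⟨φ, hφ, hC⟩ := hC
  simp only [vars, CNF.vars, Finset.mem_biUnion, Finset.mem_image]
  exact ⟨φ, hφ, C, hC, l, hl, rfl⟩

/-- Only an inclusion can be had: the formulas of `W` are merged into one, and conclusions gain a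
unit clause. -/
theorem exists_mem_formulas_reduct {T : DefaultTheory} (y : ℕ → Var) (e : ExtLit) {φ : CNF}
    (hφ : φ ∈ T.formulas) : ∃ ψ ∈ (T.reduct y e).formulas, φ.reduct e ⊆ ψ := by
  rw [mem_formulas] at hφ
  simp only [mem_formulas, reduct, Finset.mem_singleton]
  rcases hφ with hφ | ⟨d, hd, h⟩
  · exact ⟨_, .inl rfl, fun C hC => Finset.mem_biUnion.2 ⟨φ, hφ, hC⟩⟩
  · obtain ⟨i, hi, rfl⟩ := List.getElem_of_mem hd
    rcases h with rfl | rfl | rfl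
    · exact ⟨_, .inr ⟨_, List.mem_mapIdx.2 ⟨i, hi, rfl⟩, .inl rfl⟩, subset_rfl⟩
    · exact ⟨_, .inr ⟨_, List.mem_mapIdx.2 ⟨i, hi, rfl⟩, .inr (.inl rfl)⟩, subset_rfl⟩
    · exact ⟨_, .inr ⟨_, List.mem_mapIdx.2 ⟨i, hi, rfl⟩, .inr (.inr rfl)⟩,
        Finset.subset_insert _ _⟩

theorem exists_of_mem_clauses_reduct {T : DefaultTheory} {y : ℕ → Var} {e : ExtLit} {D : Clause}
    (hD : D ∈ (T.reduct y e).clauses) :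
    (∃ i, D = {⟨y i, true⟩}) ∨ ∃ φ ∈ T.formulas, D ∈ φ.reduct e := by
  obtain ⟨ψ, hψ, hD⟩ := hD
  simp only [mem_formulas, reduct, Finset.mem_singleton] at hψ ⊢
  rcases hψ with rfl | ⟨d, hd, h⟩
  · obtain ⟨φ, hφ, hD⟩ := Finset.mem_biUnion.1 hD
    exact .inr ⟨φ, .inl hφ, hD⟩
  · obtain ⟨i, hi, rfl⟩ := List.mem_mapIdx.1 hd
    rcases h with rfl | rfl | rfl
    · exact .inr ⟨_, .inr ⟨_, List.getElem_mem hi, .inl rfl⟩, hD⟩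
    · exact .inr ⟨_, .inr ⟨_, List.getElem_mem hi, .inr (.inl rfl)⟩, hD⟩
    · rcases Finset.mem_insert.1 hD with h | h
      · exact .inl ⟨i, h⟩
      · exact .inr ⟨_, .inr ⟨_, List.getElem_mem hi, .inr (.inr rfl)⟩, h⟩

end DefaultTheory

theorem Lit.var_eq_iff {l l' : Lit} : l.var = l'.var ↔ l = l' ∨ l = l'.neg := by
  obtain ⟨x, b⟩ := l
  obtain ⟨x', b'⟩ := l'
  cases b <;> cases b' <;> simp [Lit.neg]

/-- A surviving clause loses its variable whatever the extended literal is: for a literal `l`,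
survival means that `l` is absent, and `l.neg` is erased. The reduct by `x_ε` is thus the largest
possible one. -/
theorem CNF.exists_subset_of_mem_reduct {φ : CNF} {e : ExtLit} {D : Clause}
    (hD : D ∈ φ.reduct e) : ∃ C ∈ φ, D ⊆ C.filter fun l => l.var ≠ e.var := by
  cases e with
  | lit l =>
    simp only [CNF.reduct, Finset.mem_image, Finset.mem_filter] at hD
    obtain ⟨C, ⟨hC, hl⟩, rfl⟩ := hD
    refine ⟨C, hC, fun l' hl' => ?_⟩
    rw [Finset.mem_erase] at hl'
    refine Finset.mem_filter.2 ⟨hl'.2, fun h => ?_⟩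
    rcases Lit.var_eq_iff.1 h with rfl | rfl
    · exact hl hl'.2
    · exact hl'.1 rfl
  | eps x =>
    simp only [CNF.reduct, Finset.mem_image] at hD
    obtain ⟨C, hC, rfl⟩ := hD
    exact ⟨C, hC, subset_rfl⟩

namespace DefaultTheory

/-- The symbols `x_ε` never delete a clause, so each clause leaves a trace, and this trace is known
exactly. -/
theorem filter_mem_clauses_reducts (y : ℕ → Var) (L : List Var) {T : DefaultTheory} {C : Clause}
    (hC : C ∈ T.clauses) :
    (C.filter fun l => l.var ∉ L) ∈ (T.reducts y (L.map .eps)).clauses := by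
  induction L generalizing T C with
  | nil => simpa [reducts] using hC
  | cons x L ih =>
    have h : (C.filter fun l => l.var ≠ x) ∈ (T.reduct y (.eps x)).clauses := by
      obtain ⟨φ, hφ, hC⟩ := hC
      obtain ⟨ψ, hψ, h⟩ := exists_mem_formulas_reduct y (.eps x) hφ
      exact ⟨ψ, hψ, h (Finset.mem_image_of_mem _ hC)⟩
    have := ih h
    rw [Finset.filter_filter] at this
    simpa [reducts, and_comm] using this

/-- A unit added by one reduct passes through the later ones, which can only shrink it; inclusions
suffice for classes closed under subclauses. -/
theorem exists_of_mem_clauses_reducts {y : ℕ → Var} {Y : List ExtLit} {T : DefaultTheory}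
    {D : Clause} (hD : D ∈ (T.reducts y Y).clauses) :
    (∃ i, D ⊆ {⟨y i, true⟩}) ∨
      ∃ C ∈ T.clauses, D ⊆ C.filter fun l => l.var ∉ Y.map ExtLit.var := by
  induction Y generalizing T with
  | nil => exact .inr ⟨D, hD, by simp⟩
  | cons e Y ih =>
    rcases ih (T := T.reduct y e) hD with h | ⟨C, hC, h⟩
    · exact .inl h
    rcases exists_of_mem_clauses_reduct hC with ⟨i, rfl⟩ | ⟨φ, hφ, hC⟩
    · exact .inl ⟨i, h.trans (Finset.filter_subset _ _)⟩
    · obtain ⟨C', hC', h'⟩ := CNF.exists_subset_of_mem_reduct hC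
      refine .inr ⟨C', ⟨φ, hφ, hC'⟩, fun l hl => ?_⟩
      have h₁ := Finset.mem_filter.1 (h hl)
      have h₂ := Finset.mem_filter.1 (h' h₁.1)
      simp only [List.map_cons, List.mem_cons, not_or, Finset.mem_filter]
      exact ⟨h₂.1, h₂.2, h₁.2⟩

end DefaultTheory

theorem isThreefold_eps (B : Finset Var) : IsThreefold B (B.toList.map .eps) := by
  have h : (B.toList.map ExtLit.eps).map ExtLit.var = B.toList := by
    rw [List.map_map]; exact List.map_id _
  rw [IsThreefold, h]
  exact ⟨B.nodup_toList, by simp⟩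

theorem exists_fresh (V : Finset Var) : ∃ y : ℕ → Var, Function.Injective y ∧ ∀ i, y i ∉ V := by
  have : Infinite {x : Var // x ∉ V} := (Finset.finite_toSet V).infinite_compl.to_subtype
  let f := Infinite.natEmbedding {x : Var // x ∉ V}
  exact ⟨fun i => (f i).1, Subtype.val_injective.comp f.injective, fun i => (f i).2⟩

/-- If membership in a class is decided clause by clause, and is inherited by subclauses, then the
strong backdoors are the sets whose removal turns all clauses into admissible ones. -/
theorem isStrongBackdoor_setOf_iff {Good : Clause → Prop} (hmono : ∀ C D, C ⊆ D → Good D → Good C)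
    (hunit : ∀ x, Good {⟨x, true⟩}) (T : DefaultTheory) (B : Finset Var) :
    IsStrongBackdoor {φ | ∀ C ∈ φ, Good C} T B ↔
      B ⊆ T.vars ∧ ∀ C ∈ T.clauses, Good (C.filter fun l => l.var ∉ B) := by
  refine and_congr_right fun _ => ⟨fun h C hC => ?_, fun h y _ _ Y hY => ?_⟩
  -- The definition quantifies over fresh `y`, so one has to exist before the assignment by symbols
  -- `x_ε` can be tested.
  · obtain ⟨y, hy, hy'⟩ := exists_fresh T.vars
    have := DefaultTheory.isIn_setOf_iff.1 (h y hy hy' _ (isThreefold_eps B)) _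
      (DefaultTheory.filter_mem_clauses_reducts y B.toList hC)
    simpa using this
  · refine DefaultTheory.isIn_setOf_iff.2 fun D hD => ?_
    rcases DefaultTheory.exists_of_mem_clauses_reducts hD with ⟨i, hi⟩ | ⟨C, hC, hD⟩
    · exact hmono _ _ hi (hunit _)
    · refine hmono _ _ hD ?_
      convert h C hC using 5
      rw [← hY.2, List.mem_toFinset]

/-! ### The backdoors for the four target classes -/

/-- Distinct positive literals have distinct variables, so two of them surviving in a clause are the
same thing as an edge with both ends outside `B`. -/
theorem isStrongBackdoor_horn_iff (T : DefaultTheory) (B : Finset Var) (hB : B ⊆ T.vars) :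
    IsStrongBackdoor Horn T B ↔ (hornGraph T).IsVertexCover (B : Set Var) := by
  refine (isStrongBackdoor_setOf_iff (fun C D h hD => (Finset.card_le_card
    (Finset.filter_subset_filter _ h)).trans hD) (fun x => (Finset.card_filter_le _ _)) T B).trans ?_
  simp only [hB, true_and, Finset.card_le_one, Finset.mem_filter]
  constructor
  · rintro h x z ⟨hne, φ, hφ, C, hC, hx, hz⟩
    by_contra! hn
    exact hne (congrArg Lit.var (h C ⟨φ, hφ, hC⟩ ⟨x, true⟩ ⟨⟨hx, hn.1⟩, rfl⟩ ⟨z, true⟩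
      ⟨⟨hz, hn.2⟩, rfl⟩))
  · rintro h C ⟨φ, hφ, hC⟩ ⟨x, _⟩ ⟨⟨hx, hxB⟩, rfl⟩ ⟨z, _⟩ ⟨⟨hz, hzB⟩, rfl⟩
    by_contra hne
    rcases h (v := x) (w := z) ⟨fun h => hne (by rw [h]), φ, hφ, C, hC, hx, hz⟩ with h | h
    · exact hxB h
    · exact hzB h

theorem isStrongBackdoor_posUnit_iff (T : DefaultTheory) (B : Finset Var) (hB : B ⊆ T.vars) :
    IsStrongBackdoor PosUnit T B ↔
      (primalGraph T).IsVertexCover (B : Set Var) ∧ negVars T ⊆ (B : Set Var) := by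
  refine (isStrongBackdoor_setOf_iff (Good := fun C => C.card ≤ 1 ∧ ∀ l ∈ C, l.pos = true)
    (fun C D h hD => ⟨(Finset.card_le_card h).trans hD.1, fun l hl => hD.2 l (h hl)⟩)
    (fun x => by simp) T B).trans ?_
  simp only [hB, true_and, Finset.card_le_one, Finset.mem_filter]
  constructor
  · refine fun h => ⟨?_, ?_⟩
    · rintro x z ⟨hne, φ, hφ, C, hC, hx, hz⟩
      obtain ⟨l, hl, rfl⟩ := Finset.mem_image.1 hx
      obtain ⟨l', hl', rfl⟩ := Finset.mem_image.1 hz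
      by_contra! hn
      exact hne (congrArg Lit.var ((h C ⟨φ, hφ, hC⟩).1 l ⟨hl, hn.1⟩ l' ⟨hl', hn.2⟩))
    · rintro x ⟨φ, hφ, C, hC, hx⟩
      by_contra hn
      exact absurd ((h C ⟨φ, hφ, hC⟩).2 ⟨x, false⟩ ⟨hx, hn⟩) (by simp)
  · rintro ⟨h, hneg⟩ C ⟨φ, hφ, hC⟩
    -- Once all survivors are positive, distinct survivors have distinct variables and therefore
    -- form an edge; the pair `x`, `¬x`, which spans no edge, is ruled out by the loops.
    have hpos : ∀ l : Lit, l ∈ C ∧ l.var ∉ B → l.pos = true := by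
      rintro ⟨x, _ | _⟩ ⟨hl, hlB⟩
      · exact absurd (hneg ⟨φ, hφ, C, hC, hl⟩) hlB
      · rfl
    refine ⟨fun l hl l' hl' => ?_, hpos⟩
    by_contra hne
    have hne' : l.var ≠ l'.var := fun hv => by
      have h₁ := hpos l hl
      have h₂ := hpos l' hl'
      obtain ⟨x, b⟩ := l
      obtain ⟨x', b'⟩ := l'
      simp_all
    rcases h (v := l.var) (w := l'.var) ⟨hne', φ, hφ, C, hC, Finset.mem_image_of_mem _ hl.1,
      Finset.mem_image_of_mem _ hl'.1⟩ with h | h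
    · exact hl.2 h
    · exact hl'.2 h

theorem isStrongBackdoor_krom_iff (T : DefaultTheory) (B : Finset Var) (hB : B ⊆ T.vars)
    (hT : T.TautologyFree) :
    IsStrongBackdoor Krom T B ↔ IsHittingSet (kromHypergraph T) B := by
  refine (isStrongBackdoor_setOf_iff (fun C D h hD => (Finset.card_le_card h).trans hD)
    (fun x => by simp) T B).trans ?_
  simp only [hB, true_and]
  constructor
  · rintro h e ⟨he, φ, hφ, C, hC, heC⟩
    by_contra hn
    rw [Finset.not_nonempty_iff_eq_empty, ← Finset.disjoint_iff_inter_eq_empty] at hn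
    have h₁ : e ⊆ (C.filter fun l => l.var ∉ B).image Lit.var := fun x hx => by
      obtain ⟨l, hl, rfl⟩ := Finset.mem_image.1 (heC hx)
      exact Finset.mem_image_of_mem _ (Finset.mem_filter.2 ⟨hl, Finset.disjoint_left.1 hn hx⟩)
    have h₂ := (Finset.card_le_card h₁).trans Finset.card_image_le
    have h₃ := h C ⟨φ, hφ, hC⟩
    omega
  · rintro h C ⟨φ, hφ, hC⟩
    by_contra! hn
    obtain ⟨D, hD, hD3⟩ := Finset.exists_subset_card_eq hn
    have hDC : ∀ l ∈ D, l ∈ C := fun l hl => (Finset.mem_filter.1 (hD hl)).1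
    -- Three literals need not have three variables: `{x, ¬x, z}` violates `Krom` but contains no
    -- hyperedge. Tautology-freeness excludes this.
    have hinj : Set.InjOn Lit.var (D : Set Lit) := fun l hl l' hl' hv => by
      rcases Lit.var_eq_iff.1 hv with h | rfl
      · exact h
      · exact absurd (hDC _ hl) (hT φ hφ C hC _ (hDC _ hl'))
    obtain ⟨x, hx⟩ := h (D.image Lit.var) ⟨by rw [Finset.card_image_of_injOn hinj, hD3], φ, hφ, C,
      hC, Finset.image_subset_image hDC⟩
    obtain ⟨hx, hxB⟩ := Finset.mem_inter.1 hx
    obtain ⟨l, hl, rfl⟩ := Finset.mem_image.1 hx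
    exact (Finset.mem_filter.1 (hD hl)).2 hxB

theorem isStrongBackdoor_monotone_iff (T : DefaultTheory) (B : Finset Var) (hB : B ⊆ T.vars) :
    IsStrongBackdoor Monotone T B ↔ negVars T ⊆ (B : Set Var) := by
  refine (isStrongBackdoor_setOf_iff (Good := fun C => ∀ l ∈ C, l.pos = true)
    (fun C D h hD l hl => hD l (h hl)) (fun x => by simp) T B).trans ?_
  simp only [hB, true_and, Finset.mem_filter]
  constructor
  · rintro h x ⟨φ, hφ, C, hC, hx⟩
    by_contra hn
    exact absurd (h C ⟨φ, hφ, hC⟩ ⟨x, false⟩ ⟨hx, hn⟩) (by simp)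
  · rintro h C ⟨φ, hφ, hC⟩ ⟨x, _ | _⟩ ⟨hl, hlB⟩
    · exact absurd (h ⟨φ, hφ, C, hC, hl⟩) hlB
    · rfl

/-! ### The target classes by weights of literals -/

/-- The clauses of weight less than `thr`, a literal of sign `b` having the weight `wt b`. -/
def Light (wt : Bool → ℕ) (thr : ℕ) (C : Clause) : Prop := ∑ l ∈ C, wt l.pos < thr

theorem Light.mono {wt : Bool → ℕ} {thr : ℕ} {C D : Clause} (h : C ⊆ D) (hD : Light wt thr D) :
    Light wt thr C :=
  (Finset.sum_le_sum_of_subset h).trans_lt hD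

/-- The weights which define the target classes. -/
def IsWeighting (wt : Bool → ℕ) (thr : ℕ) (Θ : Set CNF) : Prop :=
  (∀ b, wt b ≤ 2) ∧ thr ≤ 3 ∧ wt true < thr ∧ Θ = {φ | ∀ C ∈ φ, Light wt thr C}

/-- The weights of positive and negative literals and the threshold are 1, 0, 2 for `Horn`; 1, 2, 2
for `PosUnit`, where one negative literal is already too heavy; 1, 1, 3 for `Krom`; and 0, 1, 1 for
`Monotone`. Counting literals rather than variables makes tautological clauses harmless for the
algorithm. -/
theorem exists_isWeighting {Θ : Set CNF}
    (hΘ : Θ ∈ ({Horn, PosUnit, Krom, Monotone} : Set (Set CNF))) :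
    ∃ wt thr, IsWeighting wt thr Θ := by
  rcases hΘ with rfl | rfl | rfl | rfl
  · refine ⟨fun b => if b then 1 else 0, 2, by decide, by decide, by decide, ?_⟩
    ext φ
    refine forall₂_congr fun C _ => ?_
    simp only [Light, Finset.card_filter]
    omega
  · refine ⟨fun b => if b then 1 else 2, 2, by decide, by decide, by decide, ?_⟩
    ext φ
    refine forall₂_congr fun C _ => ?_
    simp only [Light]
    constructor
    · rintro ⟨h₁, h₂⟩
      rw [Finset.sum_congr rfl (g := fun _ => 1) fun l hl => by simp [h₂ l hl]]
      simp only [Finset.sum_const, smul_eq_mul, mul_one]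
      omega
    · intro h
      refine ⟨?_, fun l hl => ?_⟩
      · have : C.card ≤ ∑ l ∈ C, if l.pos = true then 1 else 2 := by
          rw [Finset.card_eq_sum_ones]
          exact Finset.sum_le_sum fun l _ => by split <;> omega
        omega
      · have := Finset.single_le_sum (f := fun l : Lit => if l.pos = true then 1 else 2)
          (fun _ _ => Nat.zero_le _) hl
        by_contra hn
        simp only [hn] at this
        simp at this
        omega
  · refine ⟨fun _ => 1, 3, by decide, by decide, by decide, ?_⟩
    ext φ
    refine forall₂_congr fun C _ => ?_
    simp only [Light, Finset.sum_const, smul_eq_mul, mul_one]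
    omega
  · refine ⟨fun b => if b then 0 else 1, 1, by decide, by decide, by decide, ?_⟩
    ext φ
    refine forall₂_congr fun C _ => ?_
    simp [Light]

theorem IsWeighting.isStrongBackdoor_iff {wt : Bool → ℕ} {thr : ℕ} {Θ : Set CNF}
    (h : IsWeighting wt thr Θ) (T : DefaultTheory) (B : Finset Var) :
    IsStrongBackdoor Θ T B ↔
      B ⊆ T.vars ∧ ∀ C ∈ T.clauses, Light wt thr (C.filter fun l => l.var ∉ B) := by
  rw [h.2.2.2]
  exact isStrongBackdoor_setOf_iff (fun C D hCD hD => hD.mono hCD)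
    (fun x => by simpa [Light] using h.2.2.1) T B

end DefaultLogic

namespace DefaultLogic
open Turing Function

/-! ### A structured language for multi-stack machines -/

/-- Structured programs acting on allStacks over `G`, which are indexed by `K`, and on an internal
state in `σ`. -/
inductive Cmd (K G σ : Type)
  | pop (k : K) (f : σ → Option G → σ)
  | push (k : K) (f : σ → G)
  | load (f : σ → σ)
  | seq (c d : Cmd K G σ)
  | ite (p : σ → Bool) (c d : Cmd K G σ)
  | loop (p : σ → Bool) (c : Cmd K G σ)

namespace Cmd

infixr:65 " ;; " => Cmd.seq

variable {K G σ : Type}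

/-- `Runs c s s' n`: started in `s`, the program `c` terminates in `s'` after exactly `n` steps. -/
inductive Runs [DecidableEq K] :
    Cmd K G σ → σ × (K → List G) → σ × (K → List G) → ℕ → Prop
  | pop {k f v S} : Runs (pop k f) (v, S) (f v (S k).head?, update S k (S k).tail) 1
  | push {k f v S} : Runs (push k f) (v, S) (v, update S k (f v :: S k)) 1
  | load {f v S} : Runs (load f) (v, S) (f v, S) 1
  | seq {c d s s' s'' m n} : Runs c s s' m → Runs d s' s'' n → Runs (seq c d) s s'' (m + n)
  | ite_true {p c d s s' n} : p s.1 = true → Runs c s s' n → Runs (ite p c d) s s' (1 + n)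
  | ite_false {p c d s s' n} : p s.1 = false → Runs d s s' n → Runs (ite p c d) s s' (1 + n)
  | loop_done {p c s} : p s.1 = false → Runs (loop p c) s s 1
  | loop_step {p c s s' s'' m n} : p s.1 = true → Runs c s s' m → Runs (loop p c) s' s'' n →
      Runs (loop p c) s s'' (1 + (m + n))

/-- One step pushes at most one symbol. This later bounds the cost of erasing the stacks by the
running time. -/
theorem Runs.length_le [DecidableEq K] {c : Cmd K G σ} {s s' : σ × (K → List G)} {n : ℕ}
    (h : Runs c s s' n) (k : K) : (s'.2 k).length ≤ (s.2 k).length + n := by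
  induction h with
  | @pop k' f v S =>
    by_cases h : k = k'
    · subst h; simp; omega
    · simp [h]
  | @push k' f v S =>
    by_cases h : k = k'
    · subst h; simp
    · simp [h]
  | load => simp
  | seq _ _ ih₁ ih₂ => omega
  | ite_true _ _ ih => omega
  | ite_false _ _ ih => omega
  | loop_done => simp
  | loop_step _ _ _ ih₁ ih₂ => omega

/-- Termination in at most `n` steps. -/
def RunsLe [DecidableEq K] (c : Cmd K G σ) (s s' : σ × (K → List G)) (n : ℕ) : Prop :=
  ∃ m ≤ n, Runs c s s' m

/-! ### Compilation -/

/-- The labels of the compiled program. -/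
def Lbl : Cmd K G σ → Type
  | pop _ _ => Unit
  | push _ _ => Unit
  | load _ => Unit
  | seq c d => Lbl c ⊕ Lbl d
  | ite _ c d => Unit ⊕ (Lbl c ⊕ Lbl d)
  | loop _ c => Unit ⊕ Lbl c

/-- There are finitely many labels. -/
@[reducible]
def lblFintype : ∀ c : Cmd K G σ, Fintype (Lbl c)
  | pop _ _ => inferInstanceAs (Fintype Unit)
  | push _ _ => inferInstanceAs (Fintype Unit)
  | load _ => inferInstanceAs (Fintype Unit)
  | seq c d => @instFintypeSum _ _ (lblFintype c) (lblFintype d)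
  | ite _ c d => @instFintypeSum _ _ _ (@instFintypeSum _ _ (lblFintype c) (lblFintype d))
  | loop _ c => @instFintypeSum _ _ _ (lblFintype c)

/-- The label at which the compiled program starts. -/
def entry : ∀ c : Cmd K G σ, Lbl c
  | pop _ _ => ()
  | push _ _ => ()
  | load _ => ()
  | seq c _ => Sum.inl (entry c)
  | ite _ _ _ => Sum.inl ()
  | loop _ _ => Sum.inl ()

/-- The alphabets of the machine: there is one further stack for the output. -/
abbrev Alph (K G : Type) : Option K → Type
  | none => Bool
  | some _ => G

/-- All stacks of the machine. -/
def allStacks (S : K → List G) (o : List Bool) : ∀ k, List (Alph K G k)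
  | none => o
  | some k => S k

/-- The compiled program, with its labels embedded into `Λ`, and the label `exit` at which the
computation is continued. -/
def code {Λ : Type} : ∀ c : Cmd K G σ, (Lbl c → Λ) → Λ → Lbl c → TM2.Stmt (Alph K G) Λ σ
  | pop k f, _, exit, _ => .pop (some k) f (.goto fun _ => exit)
  | push k f, _, exit, _ => .push (some k) f (.goto fun _ => exit)
  | load f, _, exit, _ => .load f (.goto fun _ => exit)
  | seq c d, emb, _, Sum.inl l => code c (fun l => emb (Sum.inl l)) (emb (Sum.inr (entry d))) l
  | seq _ d, emb, exit, Sum.inr l => code d (fun l => emb (Sum.inr l)) exit l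
  | ite p c d, emb, _, Sum.inl _ =>
      .branch p (.goto fun _ => emb (Sum.inr (Sum.inl (entry c))))
        (.goto fun _ => emb (Sum.inr (Sum.inr (entry d))))
  | ite _ c _, emb, exit, Sum.inr (Sum.inl l) =>
      code c (fun l => emb (Sum.inr (Sum.inl l))) exit l
  | ite _ _ d, emb, exit, Sum.inr (Sum.inr l) =>
      code d (fun l => emb (Sum.inr (Sum.inr l))) exit l
  | loop p c, emb, exit, Sum.inl _ =>
      .branch p (.goto fun _ => emb (Sum.inr (entry c))) (.goto fun _ => exit)
  | loop _ c, emb, _, Sum.inr l => code c (fun l => emb (Sum.inr l)) (emb (Sum.inl ())) l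

variable [DecidableEq K]

theorem update_allStacks (S : K → List G) (o : List Bool) (k : K) (w : List G) :
    update (allStacks S o) (some k) w = allStacks (update S k w) o := by
  funext k'
  cases k' with
  | none => simp [allStacks]
  | some k' =>
    by_cases h : k' = k
    · subst h; simp [allStacks]
    · simp [allStacks, h]

/-- Each unit of time in `Runs` is exactly one machine step. The embedding and the exit label are
arbitrary because a subprogram lives inside a larger label type and continues wherever its context
says. -/
theorem Runs.iterate_step {Λ : Type} {M : Λ → TM2.Stmt (Alph K G) Λ σ} {c : Cmd K G σ}
    {s s' : σ × (K → List G)} {n : ℕ} (h : Runs c s s' n) (emb : Lbl c → Λ) (exit : Λ)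
    (hM : ∀ l, M (emb l) = code c emb exit l) (o : List Bool) :
    (flip bind (TM2.step M))^[n] (some ⟨some (emb (entry c)), s.1, allStacks s.2 o⟩) =
      some ⟨some exit, s'.1, allStacks s'.2 o⟩ := by
  induction h generalizing exit with
  | pop =>
    simp only [iterate_one, flip, Option.bind_eq_bind, Option.bind_some, TM2.step, hM, code,
      TM2.stepAux, update_allStacks]
    rfl
  | push =>
    simp only [iterate_one, flip, Option.bind_eq_bind, Option.bind_some, TM2.step, hM, code,
      TM2.stepAux, update_allStacks]
    rfl
  | load =>
    simp only [iterate_one, flip, Option.bind_eq_bind, Option.bind_some, TM2.step, hM, code,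
      TM2.stepAux]
  | @seq c d s s' s'' m n _ _ ih₁ ih₂ =>
    -- The inner iterate acts first, hence the swap of the summands.
    rw [add_comm, iterate_add_apply]
    have h₁ := ih₁ (fun l => emb (Sum.inl l)) (emb (Sum.inr (entry d)))
      (fun l => hM (Sum.inl l))
    have h₂ := ih₂ (fun l => emb (Sum.inr l)) exit (fun l => hM (Sum.inr l))
    exact (congrArg _ h₁).trans h₂
  | @ite_true p c d s s' n hp _ ih =>
    rw [add_comm, iterate_add_apply, iterate_one]
    have h := hM (Sum.inl ())
    have h₁ := ih (fun l => emb (Sum.inr (Sum.inl l))) exit (fun l => hM (Sum.inr (Sum.inl l)))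
    refine (congrArg _ ?_).trans h₁
    simp only [entry, flip, Option.bind_eq_bind, Option.bind_some, TM2.step, h, code,
      TM2.stepAux, hp, cond_true]
  | @ite_false p c d s s' n hp _ ih =>
    rw [add_comm, iterate_add_apply, iterate_one]
    have h := hM (Sum.inl ())
    have h₁ := ih (fun l => emb (Sum.inr (Sum.inr l))) exit (fun l => hM (Sum.inr (Sum.inr l)))
    refine (congrArg _ ?_).trans h₁
    simp only [entry, flip, Option.bind_eq_bind, Option.bind_some, TM2.step, h, code,
      TM2.stepAux, hp, cond_false]
  | loop_done hp =>
    have h := hM (Sum.inl ())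
    simp only [iterate_one, entry, flip, Option.bind_eq_bind, Option.bind_some, TM2.step, h, code,
      TM2.stepAux, hp, cond_false]
  | @loop_step p c s s' s'' m n hp _ _ ih₁ ih₂ =>
    rw [add_comm, iterate_add_apply, iterate_one, add_comm, iterate_add_apply]
    have h := hM (Sum.inl ())
    -- The body exits to the label of the loop test, so what follows is a run of the same compiled
    -- loop.
    have h₁ := ih₁ (fun l => emb (Sum.inr l)) (emb (Sum.inl ())) (fun l => hM (Sum.inr l))
    have h₂ := ih₂ emb exit hM
    refine (congrArg _ ((congrArg _ ?_).trans h₁)).trans h₂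
    simp only [entry, flip, Option.bind_eq_bind, Option.bind_some, TM2.step, h, code,
      TM2.stepAux, hp, cond_true]

/-- The Turing machine that executes the program and then outputs a bit. -/
def machine [Fintype K] [Fintype G] [Fintype σ] (c : Cmd K G σ) (inp : K) (v₀ : σ)
    (out : σ → Bool) : FinTM2 where
  K := Option K
  k₀ := some inp
  k₁ := none
  Γ := Alph K G
  Λ := Option (Lbl c)
  main := some (entry c)
  ΛFin := @instFintypeOption _ (lblFintype c)
  σ := σ
  initialState := v₀
  Γk₀Fin := inferInstanceAs (Fintype G)
  m
    | some l => code c some none l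
    | none => .push none out (.load (fun _ => v₀) .halt)

/-- The halting configuration is prescribed completely: initial internal state, and nothing on any
stack but the output. Therefore `c` has to empty all its stacks, and the last statement of the
machine, paid for by `time + 1`, writes the bit and resets the state. -/
theorem inP_of_runsLe [Fintype K] [Fintype G] [Fintype σ] {α : Type}
    (e : Computability.Encoding α G) (χ : α → Bool) (c : Cmd K G σ) (inp : K) (v₀ : σ)
    (out : σ → Bool) (time : Polynomial ℕ)
    (h : ∀ a, ∃ v, RunsLe c (v₀, update (fun _ => []) inp (e.encode a)) (v, fun _ => [])
      (time.eval (e.encode a).length) ∧ out v = χ a) :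
    InP e {a | χ a = true} := by
  refine ⟨χ, fun a => Iff.rfl, ⟨⟨⟨machine c inp v₀ out, Equiv.refl _, Equiv.refl _⟩, time + 1,
    fun a => ?_⟩⟩⟩
  choose v hr hout using h
  choose n hn hv using hr
  refine ⟨⟨n a + 1, ?_⟩, by simpa using hn a⟩
  rw [iterate_succ_apply']
  have h₁ := (hv a).iterate_step (M := (machine c inp v₀ out).m) some none (fun _ => rfl) []
  have h₂ : initList (machine c inp v₀ out) (List.map (Equiv.refl _).invFun (e.encode a)) =
      ⟨some (some (entry c)), v₀, allStacks (update (fun _ => []) inp (e.encode a)) []⟩ := by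
    refine congrArg (TM2.Cfg.mk _ _) ?_
    funext k
    cases k with
    | none => rfl
    | some k =>
      by_cases hk : k = inp
      · subst hk
        simp only [allStacks, update_self, machine, Equiv.invFun_as_coe, Equiv.refl_symm,
          Equiv.coe_refl, List.map_id, dite_true]
        rfl
      · have : ¬ (some k : Option K) = (machine c inp v₀ out).k₀ := by simpa [machine] using hk
        exact (dif_neg this).trans (update_of_ne (f := fun _ => ([] : List G)) hk _).symm
  refine (congrArg _ ((congrArg _ (congrArg some h₂)).trans h₁)).trans ?_
  refine congrArg some (congrArg (TM2.Cfg.mk _ _) ?_)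
  funext k
  cases k with
  | none => exact congrArg (fun b => [b]) (hout a)
  | some k => rfl

end Cmd
end DefaultLogic

namespace DefaultLogic
open Function

/-! ### Stacks of literals -/

/-- The alphabet of the machine: the symbols of words of theories, and the symbols `0, 1, 2, 3` of
the words that guide the search. -/
abbrev Alpha := Sym ⊕ Fin 4

/-- The entries of the stacks: literals, and `none` for the end of a clause. -/
abbrev Item := Option Lit

namespace Item

/-- The last symbol of the code of an item. -/
def tag : Item → Alpha
  | none => .inl .endClause
  | some l => .inl (.sign l.pos)

/-- The code of an item without its last symbol: the reversed name of the variable. -/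
def body : Item → List Alpha
  | none => []
  | some l => l.var.reverse.map fun b => .inl (.bit b)

/-- The code of an item. -/
def code (it : Item) : List Alpha := it.body ++ [it.tag]

/-- The code of a list of items. -/
def codes (L : List Item) : List Alpha := L.flatMap code

theorem codes_cons (it : Item) (L : List Item) : codes (it :: L) = it.body ++ it.tag :: codes L := by
  simp [codes, code]

end Item

/-- Only the last symbol of the code of an item is not a bit. -/
def isTag : Alpha → Bool
  | .inl (.bit _) => false
  | _ => true

theorem Item.isTag_tag (it : Item) : isTag it.tag = true := by
  cases it <;> rfl

theorem Item.isTag_of_mem_body {it : Item} {g : Alpha} (h : g ∈ it.body) : isTag g = false := by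
  cases it with
  | none => simp [body] at h
  | some l =>
    simp only [body, List.mem_map] at h
    obtain ⟨b, _, rfl⟩ := h
    rfl

/-- The stacks: the input, two auxiliary stacks, and stacks of items. -/
inductive Stk (I : Type)
  | inp
  | tA
  | tB
  | item (i : I)
  deriving DecidableEq

instance {I : Type} [Fintype I] : Fintype (Stk I) :=
  Fintype.ofEquiv (Option (Option (Option I)))
    { toFun := fun
        | none => .inp
        | some none => .tA
        | some (some none) => .tB
        | some (some (some i)) => .item i
      invFun := fun
        | .inp => none
        | .tA => some none
        | .tB => some (some none)
        | .item i => some (some (some i))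
      left_inv := by rintro (_ | _ | _ | _) <;> rfl
      right_inv := by rintro (_ | _ | _ | _) <;> rfl }

/-- The internal state: some registers for the elementary operations, and a memory in `M`. -/
structure Regs (M : Type) where
  x : Option Alpha
  y : Option Alpha
  go : Bool
  eq : Bool
  mem : M

instance {M : Type} [Fintype M] : Fintype (Regs M) :=
  Fintype.ofEquiv (Option Alpha × Option Alpha × Bool × Bool × M)
    { toFun := fun r => ⟨r.1, r.2.1, r.2.2.1, r.2.2.2.1, r.2.2.2.2⟩
      invFun := fun r => (r.x, r.y, r.go, r.eq, r.mem)
      left_inv := fun _ => rfl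
      right_inv := fun _ => rfl }

/-! ### Elementary programs that carry tagged words between stacks -/

namespace Cmd

variable {M I : Type}

/-- The program that does nothing. -/
def skip {K G σ : Type} : Cmd K G σ := load id

/-- Write the symbol in the register `x` to a stack. -/
def pushX (k : Stk I) : Cmd (Stk I) Alpha (Regs M) := push k fun r => r.x.getD (.inr 0)

/-- Write the symbol in the register `y` to a stack. -/
def pushY (k : Stk I) : Cmd (Stk I) Alpha (Regs M) := push k fun r => r.y.getD (.inr 0)

/-- Move the symbols of stack `a` to stack `t`, up to and including the first tag. -/
def pull (a t : Stk I) : Cmd (Stk I) Alpha (Regs M) :=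
  load (fun r => { r with go := true }) ;;
    loop Regs.go
      (pop a (fun r o => { r with x := o, go := !(o.elim true isTag) }) ;;
        ite (fun r => r.x.isSome) (pushX t) skip)

/-- Empty stack `t`, executing `c` with each of its symbols in the register `x`. -/
def forPop (t : Stk I) (c : Cmd (Stk I) Alpha (Regs M)) : Cmd (Stk I) Alpha (Regs M) :=
  load (fun r => { r with go := true }) ;;
    loop Regs.go
      (pop t (fun r o => { r with x := o, go := o.isSome }) ;; ite Regs.go c skip)

variable [DecidableEq I]

theorem Runs.skip {K G σ : Type} [DecidableEq K] {s : σ × (K → List G)} :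
    Runs skip s s 1 := Runs.load (f := id)

theorem Runs.congr {K G σ : Type} [DecidableEq K] {c : Cmd K G σ} {s t t' : σ × (K → List G)}
    {n m : ℕ} (h : Runs c s t n) (ht : t = t') (hn : n = m) : Runs c s t' m :=
  ht ▸ hn ▸ h

theorem Runs.congr_left {K G σ : Type} [DecidableEq K] {c : Cmd K G σ} {s s' t : σ × (K → List G)}
    {n : ℕ} (h : Runs c s t n) (hs : s = s') : Runs c s' t n :=
  hs ▸ h

theorem runs_pushX {k : Stk I} {r : Regs M} {g : Alpha} (hr : r.x = some g)
    (S : Stk I → List Alpha) : Runs (pushX k) (r, S) (r, update S k (g :: S k)) 1 :=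
  Runs.push.congr (by rw [hr]; rfl) rfl

theorem runs_ite_pushX (k : Stk I) (r : Regs M) (S : Stk I → List Alpha) :
    Runs (ite (fun r => r.x.isSome) (pushX k) Cmd.skip) (r, S)
      (r, update S k (r.x.toList ++ S k)) 2 := by
  cases hr : r.x with
  | none => exact (Runs.ite_false (by simp [hr]) Runs.skip).congr (by simp) rfl
  | some g => exact (Runs.ite_true (by simp [hr]) (runs_pushX hr S)).congr (by simp) rfl

theorem runs_ite_pushY (k : Stk I) (r : Regs M) (S : Stk I → List Alpha) :
    Runs (ite (fun r => r.y.isSome) (pushY k) Cmd.skip) (r, S)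
      (r, update S k (r.y.toList ++ S k)) 2 := by
  cases hr : r.y with
  | none => exact (Runs.ite_false (by simp [hr]) Runs.skip).congr (by simp) rfl
  | some g =>
    exact (Runs.ite_true (by simp [hr]) (Runs.push (k := k))).congr (by simp [hr]) rfl

theorem runs_pull_step {a t : Stk I} (hat : a ≠ t) (r : Regs M) (S : Stk I → List Alpha) :
    Runs (pop a (fun r o => { r with x := o, go := !(o.elim true isTag) }) ;;
        ite (fun r => r.x.isSome) (pushX t) Cmd.skip) (r, S)
      ({ r with x := (S a).head?, go := !((S a).head?.elim true isTag) },
        update (update S a (S a).tail) t ((S a).head?.toList ++ S t)) 3 :=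
  (Runs.seq Runs.pop (runs_ite_pushX _ _ _)).congr (by simp [update_of_ne hat.symm]) rfl

/-- Reading from an empty stack counts as reading a tag, so the loop stops, and `x := none` reports
the emptiness. -/
theorem runs_pull_empty {a t : Stk I} (hat : a ≠ t) {r : Regs M} {S : Stk I → List Alpha}
    (h : S a = []) :
    Runs (pull a t) (r, S) ({ r with x := none, go := false }, S) 6 := by
  have h₁ := runs_pull_step hat { r with go := true } S
  have hS : update (update S a []) t (S t) = S := by rw [← h]; simp
  simp only [h, List.tail_nil, List.head?_nil, Option.toList_none, List.nil_append, hS] at h₁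
  have h₂ := Runs.loop_step (p := Regs.go) rfl h₁ (Runs.loop_done rfl)
  exact Runs.seq (Runs.load (f := fun r : Regs M => { r with go := true })) h₂

theorem runs_pull {a t : Stk I} (hat : a ≠ t) {r : Regs M} {S : Stk I → List Alpha} {w : List Alpha}
    {g : Alpha} {rest : List Alpha} (h : S a = w ++ g :: rest) (hw : ∀ g' ∈ w, isTag g' = false)
    (hg : isTag g = true) :
    Runs (pull a t) (r, S) ({ r with x := some g, go := false },
      update (update S a rest) t (g :: (w.reverse ++ S t))) (4 * w.length + 6) := by
  -- Every symbol costs one test and three steps; the tag, the final test and the initial `load`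
  -- make up the constant 6.
  have key : ∀ (w : List Alpha) (r : Regs M) (S : Stk I → List Alpha), S a = w ++ g :: rest →
      (∀ g' ∈ w, isTag g' = false) → r.go = true →
      Runs (loop Regs.go
        (pop a (fun r o => { r with x := o, go := !(o.elim true isTag) }) ;;
          ite (fun r => r.x.isSome) (pushX t) Cmd.skip)) (r, S)
        ({ r with x := some g, go := false },
          update (update S a rest) t (g :: (w.reverse ++ S t))) (4 * w.length + 5) := by
    intro w
    induction w with
    | nil =>
      intro r S h _ hr
      have h₁ := runs_pull_step hat r S
      rw [h] at h₁
      exact (Runs.loop_step (p := Regs.go) hr h₁ (Runs.loop_done (by simp [hg]))).congr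
        (by simp [hg]) rfl
    | cons g' w ih =>
      intro r S h hw hr
      have h₁ := runs_pull_step hat r S
      rw [h] at h₁
      have hg' := hw g' (by simp)
      refine (Runs.loop_step (p := Regs.go) hr h₁ (ih _ _ (by simp [update_of_ne hat])
        (fun g hg => hw g (by simp [hg])) (by simp [hg']))).congr ?_ ?_
      · refine Prod.ext rfl ?_
        funext k
        simp only [update_apply]
        split_ifs <;> simp_all
      · simp only [List.length_cons]; omega
  exact (Runs.seq (Runs.load (f := fun r : Regs M => { r with go := true }))
    (key w { r with go := true } S h hw rfl)).congr rfl (by omega)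

/-- The loop empties `t` gradually, the conclusion empties it at once. These agree because `hF`
makes the effect of the body commute with every overwriting of `t`. -/
theorem runs_forPop {t : Stk I} {c : Cmd (Stk I) Alpha (Regs M)} {n : ℕ}
    (F : (Stk I → List Alpha) → Alpha → Stk I → List Alpha)
    (hc : ∀ r S g, r.x = some g → Runs c (r, S) (r, F S g) n)
    (hF : ∀ S g w, F (update S t w) g = update (F S g) t w)
    (r : Regs M) (S : Stk I → List Alpha) :
    Runs (forPop t c) (r, S)
      ({ r with x := none, go := false }, (S t).foldl F (update S t []))
      ((n + 3) * (S t).length + 6) := by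
  have key : ∀ (w : List Alpha) (r : Regs M) (S : Stk I → List Alpha), S t = w → r.go = true →
      Runs (loop Regs.go
        (pop t (fun r o => { r with x := o, go := o.isSome }) ;; ite Regs.go c Cmd.skip)) (r, S)
        ({ r with x := none, go := false }, w.foldl F (update S t [])) ((n + 3) * w.length + 5) := by
    intro w
    induction w with
    | nil =>
      intro r S h hr
      have h₁ := Runs.pop (k := t) (v := r) (S := S)
        (f := fun r o => { r with x := o, go := o.isSome })
      rw [h] at h₁
      exact Runs.loop_step (p := Regs.go) hr (Runs.seq h₁ (Runs.ite_false rfl Runs.skip))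
        (Runs.loop_done rfl)
    | cons g w ih =>
      intro r S h hr
      have h₁ := Runs.pop (k := t) (v := r) (S := S)
        (f := fun r o => { r with x := o, go := o.isSome })
      rw [h] at h₁
      have h₂ := Runs.loop_step (p := Regs.go) hr
        (Runs.seq h₁ (Runs.ite_true (d := Cmd.skip) (p := Regs.go) rfl (hc _ _ g rfl)))
        (ih _ _ (by rw [hF]; simp) rfl)
      convert h₂ using 1
      · simp [hF]
      · simp; ring
  exact (Runs.seq (Runs.load (f := fun r : Regs M => { r with go := true }))
    (key _ { r with go := true } S rfl rfl)).congr rfl (by omega)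

/-- Empty a stack. -/
def clear (t : Stk I) : Cmd (Stk I) Alpha (Regs M) := forPop t skip

/-- Pour stack `t` onto stack `a`. -/
def pour (t a : Stk I) : Cmd (Stk I) Alpha (Regs M) := forPop t (pushX a)

/-- Pour stack `t` onto each of the stacks `a` and `b`. -/
def pourTwo (t a b : Stk I) : Cmd (Stk I) Alpha (Regs M) := forPop t (pushX a ;; pushX b)

theorem runs_clear (t : Stk I) (r : Regs M) (S : Stk I → List Alpha) :
    Runs (clear t) (r, S) ({ r with x := none, go := false }, update S t [])
      (4 * (S t).length + 6) := by
  have h := runs_forPop (t := t) (fun S _ => S) (fun r S _ _ => Runs.skip (s := (r, S)))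
    (fun _ _ _ => rfl) r S
  rwa [List.foldl_fixed'] at h
  exact fun _ => rfl

theorem foldl_update {k : Stk I} (w : List Alpha) (S : Stk I → List Alpha) :
    w.foldl (fun S g => update S k (g :: S k)) S = update S k (w.reverse ++ S k) := by
  induction w generalizing S with
  | nil => simp
  | cons g w ih => simp [ih]

theorem runs_pour {t a : Stk I} (hta : t ≠ a) (r : Regs M) (S : Stk I → List Alpha) :
    Runs (pour t a) (r, S) ({ r with x := none, go := false },
      update (update S t []) a ((S t).reverse ++ S a)) (4 * (S t).length + 6) := by
  have h := runs_forPop (t := t) (c := pushX a) (n := 1) (fun S g => update S a (g :: S a))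
    (fun r S g hr => runs_pushX hr S)
    (fun S g w => by rw [update_of_ne hta.symm, update_comm hta]) r S
  rwa [foldl_update, update_of_ne hta.symm] at h

theorem foldl_update_two {a b : Stk I} (hab : a ≠ b) (w : List Alpha) (S : Stk I → List Alpha) :
    w.foldl (fun S g => update (update S a (g :: S a)) b (g :: S b)) S =
      update (update S a (w.reverse ++ S a)) b (w.reverse ++ S b) := by
  induction w generalizing S with
  | nil => simp
  | cons g w ih =>
    simp only [List.foldl_cons, ih]
    funext k
    simp only [update_apply]
    split_ifs <;> simp_all

theorem runs_pourTwo {t a b : Stk I} (hta : t ≠ a) (htb : t ≠ b) (hab : a ≠ b) (r : Regs M)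
    (S : Stk I → List Alpha) :
    Runs (pourTwo t a b) (r, S) ({ r with x := none, go := false },
      update (update (update S t []) a ((S t).reverse ++ S a)) b ((S t).reverse ++ S b))
      (5 * (S t).length + 6) := by
  have h := runs_forPop (t := t) (c := pushX a ;; pushX b) (n := 2)
    (fun S g => update (update S a (g :: S a)) b (g :: S b))
    (fun r S g hr => (Runs.seq (runs_pushX hr S) (runs_pushX hr _)).congr
      (by rw [update_of_ne hab.symm]) rfl)
    (fun S g w => by
      funext k
      simp only [update_apply]
      split_ifs <;> simp_all) r S
  rwa [foldl_update_two hab, update_of_ne hta.symm, update_of_ne htb.symm] at h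

/-- Pour the auxiliary stacks onto `a` and `b`, comparing their contents up to `ν`. -/
def zipBack (ν : Alpha → Alpha) (a b : Stk I) : Cmd (Stk I) Alpha (Regs M) :=
  load (fun r => { r with go := true, eq := true }) ;;
    loop Regs.go
      (pop .tA (fun r o => { r with x := o }) ;;
        pop .tB (fun r o => { r with
          y := o
          go := r.x.isSome || o.isSome
          eq := r.eq && decide (r.x.map ν = o.map ν) }) ;;
        ite (fun r => r.x.isSome) (pushX a) skip ;; ite (fun r => r.y.isSome) (pushY b) skip)

theorem runs_zipBack_step {ν : Alpha → Alpha} {a b : I} (hab : a ≠ b) (r : Regs M)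
    (S : Stk I → List Alpha) :
    Runs (pop .tA (fun r o => { r with x := o }) ;;
        pop .tB (fun r o => { r with
          y := o
          go := r.x.isSome || o.isSome
          eq := r.eq && decide (r.x.map ν = o.map ν) }) ;;
        ite (fun r => r.x.isSome) (pushX (.item a)) Cmd.skip ;;
        ite (fun r => r.y.isSome) (pushY (.item b)) Cmd.skip) (r, S)
      ({ r with
          x := (S .tA).head?
          y := (S .tB).head?
          go := (S .tA).head?.isSome || (S .tB).head?.isSome
          eq := r.eq && decide ((S .tA).head?.map ν = (S .tB).head?.map ν) },
        update (update (update (update S .tA (S .tA).tail) .tB (S .tB).tail) (.item a)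
          ((S .tA).head?.toList ++ S (.item a))) (.item b)
          ((S .tB).head?.toList ++ S (.item b))) 6 :=
  (Runs.seq Runs.pop (Runs.seq Runs.pop (Runs.seq (runs_ite_pushX _ _ _)
    (runs_ite_pushY _ _ _)))).congr (by simp [hab.symm]) rfl

/-- Popping an exhausted stack yields `none`, so comparing the optional heads until both stacks are
empty also detects a difference in length. -/
theorem runs_zipBack {ν : Alpha → Alpha} {a b : I} (hab : a ≠ b) (r : Regs M)
    (S : Stk I → List Alpha) :
    RunsLe (zipBack ν (.item a) (.item b)) (r, S)
      ({ r with
          x := none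
          y := none
          go := false
          eq := decide ((S .tA).map ν = (S .tB).map ν) },
        update (update (update (update S .tA []) .tB []) (.item a)
          ((S .tA).reverse ++ S (.item a))) (.item b) ((S .tB).reverse ++ S (.item b)))
      (7 * ((S .tA).length + (S .tB).length) + 9) := by
  -- A round removes one symbol or two, so `n` is only an upper bound for the total length, and the
  -- time is only bounded.
  have key : ∀ (n : ℕ) (r : Regs M) (S : Stk I → List Alpha),
      (S .tA).length + (S .tB).length ≤ n → r.go = true →
      RunsLe (loop Regs.go
        (pop .tA (fun r o => { r with x := o }) ;;
          pop .tB (fun r o => { r with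
            y := o
            go := r.x.isSome || o.isSome
            eq := r.eq && decide (r.x.map ν = o.map ν) }) ;;
          ite (fun r => r.x.isSome) (pushX (.item a)) Cmd.skip ;;
          ite (fun r => r.y.isSome) (pushY (.item b)) Cmd.skip)) (r, S)
      ({ r with
          x := none
          y := none
          go := false
          eq := r.eq && decide ((S .tA).map ν = (S .tB).map ν) },
        update (update (update (update S .tA []) .tB []) (.item a)
          ((S .tA).reverse ++ S (.item a))) (.item b) ((S .tB).reverse ++ S (.item b)))
      (7 * n + 8) := by
    intro n
    induction n with
    | zero =>
      intro r S hn hr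
      have hu : S .tA = [] := List.length_eq_zero_iff.1 (by omega)
      have hv : S .tB = [] := List.length_eq_zero_iff.1 (by omega)
      have h := runs_zipBack_step (ν := ν) hab r S
      refine ⟨_, le_rfl, (Runs.loop_step (p := Regs.go) hr h
        (Runs.loop_done (by simp [hu, hv]))).congr ?_ rfl⟩
      simp [hu, hv]
    | succ n ih =>
      intro r S hn hr
      by_cases hn' : (S .tA).length + (S .tB).length ≤ n
      · obtain ⟨m, hm, h⟩ := ih r S hn' hr
        exact ⟨m, by omega, h⟩
      have h := runs_zipBack_step (ν := ν) hab r S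
      generalize hu : S .tA = u at h hn hn'
      generalize hv : S .tB = v at h hn hn'
      obtain ⟨m, hm, h'⟩ := ih { r with
          x := u.head?
          y := v.head?
          go := u.head?.isSome || v.head?.isSome
          eq := r.eq && decide (u.head?.map ν = v.head?.map ν) }
        (update (update (update (update S .tA u.tail) .tB v.tail) (.item a)
          (u.head?.toList ++ S (.item a))) (.item b)
          (v.head?.toList ++ S (.item b))) (by
            simp only [update_apply]
            cases u <;> cases v <;> simp at hn hn' ⊢ <;> omega) (by
            cases u <;> cases v <;> simp at hn hn' ⊢)
      refine ⟨_, ?_, (Runs.loop_step (p := Regs.go) hr h h').congr ?_ rfl⟩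
      · omega
      · refine Prod.ext ?_ ?_
        · cases u <;> cases v <;> simp [Bool.and_assoc, Bool.decide_and]
        · funext k
          cases k with
          | item i =>
            simp only [update_apply]
            cases u <;> cases v <;> simp <;> split_ifs <;> simp_all
          | _ => simp [update_apply]
  obtain ⟨m, hm, h⟩ := key _ { r with go := true, eq := true } S le_rfl rfl
  exact ⟨_, by omega, (Runs.seq (Runs.load (f := fun r : Regs M =>
    { r with go := true, eq := true })) h).congr (by simp) rfl⟩

end Cmd
end DefaultLogic

namespace DefaultLogic

/-! ### The bounded search tree -/

/-- The list of items that represents a list of clauses. -/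
def itemsOf (cs : List (List Lit)) : List Item := cs.flatMap fun c => c.map some ++ [none]

@[simp] theorem itemsOf_cons (c : List Lit) (cs : List (List Lit)) :
    itemsOf (c :: cs) = c.map some ++ none :: itemsOf cs := by
  simp [itemsOf]

theorem itemsOf_append (cs cs' : List (List Lit)) :
    itemsOf (cs ++ cs') = itemsOf cs ++ itemsOf cs' := by
  simp [itemsOf]

/-- The total weight of a list of literals. -/
def weight (wt : Bool → ℕ) (v : List Lit) : ℕ := (v.map fun l => wt l.pos).sum

/-- Collect distinct literals of nonzero weight, starting with `v` and starting afresh at the end of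
each clause, until their weight reaches the threshold. -/
def findBad (wt : Bool → ℕ) (thr : ℕ) : List Lit → List Item → Option (List Lit)
  | _, [] => none
  | _, none :: L => findBad wt thr [] L
  | v, some l :: L =>
    if l ∈ v ∨ wt l.pos = 0 then findBad wt thr v L
    else if thr ≤ weight wt (l :: v) then some (l :: v)
    else findBad wt thr (l :: v) L

/-- Delete the variable `x`. -/
def delVar (x : Var) (L : List Item) : List Item :=
  L.filter fun it => it.elim true fun l => decide (l.var ≠ x)

/-- Delete the variable of the `s`-th literal of `v`, if there is one. -/
def delNth (s : ℕ) (v : List Lit) (L : List Item) : List Item :=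
  (v.drop s).head?.elim L fun l => delVar l.var L

/-- The search along a path of the search tree. -/
def succeeds (wt : Bool → ℕ) (thr : ℕ) : List Item → List (Fin 4) → Bool
  | L, [] => (findBad wt thr [] L).isNone
  | L, s :: w => (findBad wt thr [] L).elim true fun v => succeeds wt thr (delNth s v L) w

/-- The search along several paths which are separated by the symbol `3`. -/
def search (wt : Bool → ℕ) (thr : ℕ) (L₀ : List Item) : List Item → List (Fin 4) → Bool
  | _, [] => false
  | L, s :: w => (findBad wt thr [] L).elim true fun v =>
      if s = 3 then search wt thr L₀ L₀ w else search wt thr L₀ (delNth s v L) w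

/-- The paths of length `k` of the search tree. -/
def paths : ℕ → List (List (Fin 4))
  | 0 => [[]]
  | k + 1 => (paths k).flatMap fun w => [0 :: w, 1 :: w, 2 :: w]

/-- All paths of length `k`, each of them followed by the symbol `3`. -/
def guide (k : ℕ) : List (Fin 4) := (paths k).flatMap fun w => w ++ [3]

theorem computable_guide : Computable guide := by
  have h₁ : Primrec fun w : List (Fin 4) => [0 :: w, 1 :: w, 2 :: w] := by
    have h (a : Fin 4) : Primrec fun w : List (Fin 4) => a :: w :=
      Primrec.list_cons.comp (Primrec.const a) Primrec.id
    exact Primrec.list_cons.comp (h 0) (Primrec.list_cons.comp (h 1)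
      (Primrec.list_cons.comp (h 2) (Primrec.const [])))
  have h₂ : Primrec paths := by
    refine (Primrec.nat_rec₁ (f := fun _ (L : List (List (Fin 4))) =>
      L.flatMap fun w => [0 :: w, 1 :: w, 2 :: w]) [[]]
      (Primrec.list_flatMap Primrec.snd (h₁.comp Primrec.snd).to₂).to₂).of_eq fun k => ?_
    induction k with
    | zero => rfl
    | succ k ih => rw [paths, ← ih]
  exact (Primrec.list_flatMap h₂ (Primrec.list_append.comp Primrec.snd
    (Primrec.const [3])).to₂).to_comp

theorem mem_paths_zero {w : List (Fin 4)} : w ∈ paths 0 ↔ w = [] := by simp [paths]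

theorem mem_paths_succ {k : ℕ} {w : List (Fin 4)} :
    w ∈ paths (k + 1) ↔ ∃ s : Fin 4, s.val < 3 ∧ ∃ w' ∈ paths k, w = s :: w' := by
  simp only [paths, List.mem_flatMap, List.mem_cons, List.not_mem_nil, or_false]
  constructor
  · rintro ⟨w', hw', rfl | rfl | rfl⟩
    · exact ⟨0, by decide, w', hw', rfl⟩
    · exact ⟨1, by decide, w', hw', rfl⟩
    · exact ⟨2, by decide, w', hw', rfl⟩
  · rintro ⟨s, hs, w', hw', rfl⟩
    refine ⟨w', hw', ?_⟩
    fin_cases s <;> simp at hs ⊢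

theorem exists_mem_paths (k : ℕ) : ∃ w, w ∈ paths k := by
  induction k with
  | zero => exact ⟨[], by simp [paths]⟩
  | succ k ih =>
    obtain ⟨w, hw⟩ := ih
    exact ⟨0 :: w, mem_paths_succ.2 ⟨0, by decide, w, hw, rfl⟩⟩

theorem three_notMem_of_mem_paths {k : ℕ} {w : List (Fin 4)} (hw : w ∈ paths k) : 3 ∉ w := by
  induction k generalizing w with
  | zero => simp [mem_paths_zero.1 hw]
  | succ k ih =>
    obtain ⟨s, hs, w', hw', rfl⟩ := mem_paths_succ.1 hw
    simp only [List.mem_cons, not_or]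
    exact ⟨fun h => by subst h; simp at hs, ih hw'⟩

/-- Before the separator, `search` moves as `succeeds` does. The separator itself triggers the test
at the leaf and, if a heavy clause remains, the restart from `L₀`. This is why every path in
`guide`, including the last one, ends with `3`. -/
theorem search_append {wt : Bool → ℕ} {thr : ℕ} {L₀ : List Item} {w : List (Fin 4)} (hw : 3 ∉ w)
    (L : List Item) (w' : List (Fin 4)) :
    search wt thr L₀ L (w ++ 3 :: w') = (succeeds wt thr L w || search wt thr L₀ L₀ w') := by
  induction w generalizing L with
  | nil =>
    simp only [List.nil_append, search, succeeds]
    cases findBad wt thr [] L <;> simp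
  | cons s w ih =>
    simp only [List.mem_cons, not_or] at hw
    simp only [List.cons_append, search, succeeds]
    cases findBad wt thr [] L with
    | none => simp
    | some v => simp [Ne.symm hw.1, ih hw.2]

theorem search_guide {wt : Bool → ℕ} {thr : ℕ} (L₀ : List Item) (k : ℕ) :
    search wt thr L₀ L₀ (guide k) = true ↔ ∃ w ∈ paths k, succeeds wt thr L₀ w = true := by
  have key : ∀ ws : List (List (Fin 4)), (∀ w ∈ ws, 3 ∉ w) →
      (search wt thr L₀ L₀ (ws.flatMap fun w => w ++ [3]) = true ↔
        ∃ w ∈ ws, succeeds wt thr L₀ w = true) := by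
    intro ws
    induction ws with
    | nil => simp [search]
    | cons w ws ih =>
      intro h
      rw [List.flatMap_cons, List.append_assoc, List.singleton_append,
        search_append (h w (by simp)), Bool.or_eq_true, ih fun w hw => h w (by simp [hw])]
      simp
  exact key _ fun w hw => three_notMem_of_mem_paths hw

theorem weight_eq_sum {wt : Bool → ℕ} {v : List Lit} (hv : v.Nodup) :
    weight wt v = ∑ l ∈ v.toFinset, wt l.pos :=
  (List.sum_toFinset _ hv).symm

/-- Collected literals are distinct and weigh at least 1, whence the invariant that length is at
most weight. Before the threshold is reached the weight is at most 2, so the literal that reaches it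
is at most the third. -/
theorem findBad_clause {wt : Bool → ℕ} {thr : ℕ} (hthr : thr ≤ 3) (L : List Item) (c : List Lit)
    {v : List Lit} (hv : v.Nodup) (hw : weight wt v < thr) (hl : v.length ≤ weight wt v) :
    (findBad wt thr v (c.map some ++ none :: L) = findBad wt thr [] L ∧
      Light wt thr (v.toFinset ∪ c.toFinset)) ∨
    ∃ v', findBad wt thr v (c.map some ++ none :: L) = some v' ∧ (∀ l ∈ v', l ∈ v ∨ l ∈ c) ∧
      v'.Nodup ∧ thr ≤ weight wt v' ∧ v'.length ≤ 3 := by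
  induction c generalizing v with
  | nil =>
    refine .inl ⟨rfl, ?_⟩
    rw [weight_eq_sum hv] at hw
    simpa [Light] using hw
  | cons l c ih =>
    simp only [List.map_cons, List.cons_append, findBad]
    split_ifs with h₁ h₂
    · rcases ih hv hw hl with ⟨h, h'⟩ | ⟨v', h, h', h''⟩
      · refine .inl ⟨h, ?_⟩
        -- If the skipped literal occurs elsewhere in the union, the set is unchanged; otherwise it
        -- was skipped for its weight 0.
        by_cases hlv : l ∈ v.toFinset ∪ c.toFinset
        · rwa [List.toFinset_cons, Finset.union_insert, Finset.insert_eq_of_mem hlv]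
        · have h₀ : wt l.pos = 0 := by
            rcases h₁ with h₁ | h₁
            · simp [h₁] at hlv
            · exact h₁
          rw [Light, List.toFinset_cons, Finset.union_insert, Finset.sum_insert hlv, h₀, zero_add]
          exact h'
      · exact .inr ⟨v', h, fun l' hl' => (h' l' hl').imp_right (List.mem_cons_of_mem _), h''⟩
    · rw [not_or] at h₁
      refine .inr ⟨_, rfl, fun l' hl' => ?_, List.nodup_cons.2 ⟨h₁.1, hv⟩, h₂, ?_⟩
      · rcases List.mem_cons.1 hl' with rfl | h
        · exact .inr (by simp)
        · exact .inl h
      · simp only [List.length_cons]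
        omega
    · rw [not_or] at h₁
      rcases ih (List.nodup_cons.2 ⟨h₁.1, hv⟩) (not_le.1 h₂) (by
        simp only [weight, List.length_cons, List.map_cons, List.sum_cons] at hl ⊢
        omega) with ⟨h, h'⟩ | ⟨v', h, h', h''⟩
      · refine .inl ⟨h, ?_⟩
        simpa [List.toFinset_cons, Finset.union_insert, Finset.insert_union] using h'
      · refine .inr ⟨v', h, fun l' hl' => ?_, h''⟩
        rcases h' l' hl' with h | h
        · rcases List.mem_cons.1 h with rfl | h
          · exact .inr (by simp)
          · exact .inl h
        · exact .inr (by simp [h])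

/-- Collecting restarts at each end mark, so the literals found come from a single clause and
witness its heaviness. -/
theorem findBad_itemsOf {wt : Bool → ℕ} {thr : ℕ} (h₀ : 0 < thr) (hthr : thr ≤ 3)
    (cs : List (List Lit)) :
    (findBad wt thr [] (itemsOf cs) = none ∧ ∀ c ∈ cs, Light wt thr c.toFinset) ∨
    ∃ v, findBad wt thr [] (itemsOf cs) = some v ∧ v.length ≤ 3 ∧ ∃ c ∈ cs, (∀ l ∈ v, l ∈ c) ∧
      v.Nodup ∧ thr ≤ weight wt v := by
  induction cs with
  | nil => exact .inl ⟨rfl, by simp⟩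
  | cons c cs ih =>
    rw [itemsOf_cons]
    rcases findBad_clause hthr (itemsOf cs) c (v := []) List.nodup_nil (by simpa [weight] using h₀)
      (by simp) with ⟨h, h'⟩ | ⟨v, h, h', h₁, h₂, h₃⟩
    · rw [h]
      rcases ih with ⟨h₁, h₂⟩ | ⟨v, h₁, h₂, c', hc', h₃⟩
      · refine .inl ⟨h₁, fun c' hc' => ?_⟩
        rcases List.mem_cons.1 hc' with rfl | hc'
        · simpa using h'
        · exact h₂ c' hc'
      · exact .inr ⟨v, h₁, h₂, c', by simp [hc'], h₃⟩
    · exact .inr ⟨v, h, h₃, c, by simp, fun l hl => (h' l hl).resolve_left (by simp), h₁, h₂⟩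

theorem delVar_itemsOf (x : Var) (cs : List (List Lit)) :
    delVar x (itemsOf cs) = itemsOf (cs.map fun c => c.filter fun l => decide (l.var ≠ x)) := by
  induction cs with
  | nil => rfl
  | cons c cs ih =>
    rw [List.map_cons, itemsOf_cons, itemsOf_cons, ← ih]
    simp only [delVar, List.filter_append, List.filter_cons, Option.elim_none, if_true]
    rw [List.filter_map]
    rfl

/-- The variables in `B` are to be removed in order to make all clauses light. -/
def Solves (wt : Bool → ℕ) (thr : ℕ) (B : Finset Var) (cs : List (List Lit)) : Prop :=
  ∀ c ∈ cs, Light wt thr (c.toFinset.filter fun l => l.var ∉ B)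

theorem solves_map_filter {wt : Bool → ℕ} {thr : ℕ} {B : Finset Var} {x : Var}
    {cs : List (List Lit)} :
    Solves wt thr B (cs.map fun c => c.filter fun l => decide (l.var ≠ x)) ↔
      Solves wt thr (insert x B) cs := by
  simp only [Solves, List.mem_map, forall_exists_index, and_imp, forall_apply_eq_imp_iff₂]
  refine forall₂_congr fun c _ => ?_
  have : ((c.filter fun l => decide (l.var ≠ x)).toFinset.filter fun l => l.var ∉ B) =
      c.toFinset.filter fun l => l.var ∉ insert x B := by
    ext l
    simp [and_assoc]
  rw [this]

/-- Correctness of the bounded search tree: a solution has to meet the variables of the literals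
found, and deleting one of its variables leaves a problem solved by a set with one element fewer. -/
theorem exists_succeeds_iff {wt : Bool → ℕ} {thr : ℕ} (h₀ : 0 < thr) (hthr : thr ≤ 3) (k : ℕ)
    (cs : List (List Lit)) :
    (∃ w ∈ paths k, succeeds wt thr (itemsOf cs) w = true) ↔
      ∃ B : Finset Var, B.card ≤ k ∧ Solves wt thr B cs := by
  have hlight {cs} (h : ∀ c ∈ cs, Light wt thr c.toFinset) (B) : Solves wt thr B cs :=
    fun c hc => (h c hc).mono (Finset.filter_subset _ _)
  -- Otherwise all of `v` survives the removal of `B`, and the remainder of `c` stays heavy.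
  have hmeet {cs B} (hB : Solves wt thr B cs) {v : List Lit} {c : List Lit} (hc : c ∈ cs)
      (hvc : ∀ l ∈ v, l ∈ c) (hv : v.Nodup) (hw : thr ≤ weight wt v) : ∃ l ∈ v, l.var ∈ B := by
    by_contra! hn
    rw [weight_eq_sum hv] at hw
    refine absurd ((hB c hc).mono fun l hl => ?_) (not_lt.2 hw)
    rw [List.mem_toFinset] at hl
    simpa using ⟨hvc l hl, hn l hl⟩
  induction k generalizing cs with
  | zero =>
    simp only [mem_paths_zero, exists_eq_left, succeeds, Nat.le_zero, Finset.card_eq_zero]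
    rcases findBad_itemsOf h₀ hthr cs with ⟨h, h'⟩ | ⟨v, h, _, c, hc, h₁, h₂, h₃⟩
    · rw [h]
      exact iff_of_true rfl (hlight h' ∅)
    · simp only [h, Option.isNone_some, Bool.false_eq_true, false_iff]
      intro hB
      obtain ⟨l, _, hl⟩ := hmeet hB hc h₁ h₂ h₃
      simp at hl
  | succ k ih =>
    rcases findBad_itemsOf h₀ hthr cs with ⟨h, h'⟩ | ⟨v, h, hl, c, hc, h₁, h₂, h₃⟩
    · obtain ⟨w, hw⟩ := exists_mem_paths (k + 1)
      refine iff_of_true ⟨w, hw, ?_⟩ ⟨∅, by simp, hlight h' ∅⟩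
      cases w <;> simp [succeeds, h]
    · constructor
      · rintro ⟨w, hw, hs⟩
        obtain ⟨s, _, w', hw', rfl⟩ := mem_paths_succ.1 hw
        simp only [succeeds, h, Option.elim_some, delNth] at hs
        cases hd : (v.drop s).head? with
        | none =>
          -- A branch beyond the end of `v` deletes nothing and merely wastes one unit of the
          -- budget.
          rw [hd, Option.elim_none] at hs
          obtain ⟨B, hB, hB'⟩ := (ih cs).1 ⟨w', hw', hs⟩
          exact ⟨B, by omega, hB'⟩
        | some l =>
          rw [hd, Option.elim_some, delVar_itemsOf] at hs
          obtain ⟨B, hB, hB'⟩ := (ih _).1 ⟨w', hw', hs⟩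
          exact ⟨insert l.var B, (Finset.card_insert_le _ _).trans (by omega),
            solves_map_filter.1 hB'⟩
      · rintro ⟨B, hB, hB'⟩
        obtain ⟨l, hlv, hlB⟩ := hmeet hB' hc h₁ h₂ h₃
        -- The position of the literal whose variable lies in `B` is the branch to take; `v.length ≤
        -- 3` makes it one of 0, 1, 2.
        obtain ⟨i, hi, rfl⟩ := List.getElem_of_mem hlv
        obtain ⟨w, hw, hs⟩ := (ih (cs.map fun c => c.filter fun l' =>
          decide (l'.var ≠ v[i].var))).2 ⟨B.erase v[i].var,
            by rw [Finset.card_erase_of_mem hlB]; omega,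
            solves_map_filter.2 (by rwa [Finset.insert_erase hlB])⟩
        refine ⟨⟨i, by omega⟩ :: w, mem_paths_succ.2 ⟨⟨i, by omega⟩, by simp; omega, w, hw, rfl⟩, ?_⟩
        simp only [succeeds, h, Option.elim_some, delNth]
        rw [List.head?_drop, List.getElem?_eq_getElem hi, Option.elim_some, delVar_itemsOf]
        exact hs

/-! ### Words of default theories -/

namespace TheoryCode

/-- The list of the formulas of a theory. -/
def formulaList (c : TheoryCode) : List CNFCode := c.W ++ c.D.flatMap fun r => [r.1, r.2.1, r.2.2]

/-- The list of the clauses of a theory. -/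
def clauseList (c : TheoryCode) : List (List Lit) := c.formulaList.flatten

theorem mem_clauses_theory {c : TheoryCode} {C : Clause} :
    C ∈ c.theory.clauses ↔ ∃ cl ∈ c.clauseList, cl.toFinset = C := by
  have h : ∀ φ, φ ∈ c.theory.formulas ↔ ∃ f ∈ c.formulaList, f.toCNF = φ := by
    intro φ
    simp only [DefaultTheory.mem_formulas, theory, formulaList, List.mem_append, List.mem_toFinset,
      List.mem_map, List.mem_flatMap, List.mem_cons, List.not_mem_nil, or_false]
    constructor
    · rintro (⟨f, hf, rfl⟩ | ⟨_, ⟨r, hr, rfl⟩, rfl | rfl | rfl⟩)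
      · exact ⟨f, .inl hf, rfl⟩
      · exact ⟨_, .inr ⟨r, hr, .inl rfl⟩, rfl⟩
      · exact ⟨_, .inr ⟨r, hr, .inr (.inl rfl)⟩, rfl⟩
      · exact ⟨_, .inr ⟨r, hr, .inr (.inr rfl)⟩, rfl⟩
    · rintro ⟨f, hf | ⟨r, hr, rfl | rfl | rfl⟩, rfl⟩
      · exact .inl ⟨f, hf, rfl⟩
      · exact .inr ⟨_, ⟨r, hr, rfl⟩, .inl rfl⟩
      · exact .inr ⟨_, ⟨r, hr, rfl⟩, .inr (.inl rfl)⟩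
      · exact .inr ⟨_, ⟨r, hr, rfl⟩, .inr (.inr rfl)⟩
  simp only [DefaultTheory.clauses, Set.mem_ofPred_eq, h, clauseList, List.mem_flatten,
    exists_exists_and_eq_and]
  simp only [CNFCode.toCNF, List.mem_toFinset, List.mem_map]
  grind

end TheoryCode

/-- The search does not enforce `B ⊆ vars`. Intersecting a solution with the variables of the theory
repairs this: it is no larger and removes the same literals from the clauses. -/
theorem IsWeighting.exists_backdoor_iff {wt : Bool → ℕ} {thr : ℕ} {Θ : Set CNF}
    (h : IsWeighting wt thr Θ) (c : TheoryCode) (k : ℕ) :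
    (∃ B : Finset Var, IsStrongBackdoor Θ c.theory B ∧ B.card ≤ k) ↔
      search wt thr (itemsOf c.clauseList) (itemsOf c.clauseList) (guide k) = true := by
  rw [search_guide, exists_succeeds_iff (Nat.zero_lt_of_lt h.2.2.1) h.2.1]
  simp only [h.isStrongBackdoor_iff, TheoryCode.mem_clauses_theory, forall_exists_index, and_imp,
    forall_apply_eq_imp_iff₂]
  constructor
  · rintro ⟨B, ⟨_, hB⟩, hk⟩
    exact ⟨B, hk, hB⟩
  · rintro ⟨B, hk, hB⟩
    refine ⟨B ∩ c.theory.vars, ⟨Finset.inter_subset_right, fun cl hcl => ?_⟩,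
      (Finset.card_le_card Finset.inter_subset_left).trans hk⟩
    refine (hB cl hcl).mono fun l hl => ?_
    rw [Finset.mem_filter] at hl ⊢
    refine ⟨hl.1, fun hB => hl.2 (Finset.mem_inter.2 ⟨hB, ?_⟩)⟩
    exact DefaultTheory.mem_vars_of_mem_clauses
      (TheoryCode.mem_clauses_theory.2 ⟨cl, hcl, rfl⟩) hl.1

/-- The items that are read off a word, and the bits before the first of them. -/
def parse : List Sym → List Bool × List Item
  | [] => ([], [])
  | .bit b :: x => (b :: (parse x).1, (parse x).2)
  | .sign b :: x => ([], some ⟨(parse x).1, b⟩ :: (parse x).2)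
  | .endClause :: x => ([], none :: (parse x).2)
  | .endFormula :: x => ([], (parse x).2)
  | .endW :: x => ([], (parse x).2)

/-- The symbols that occur in clauses. -/
def isClauseSym : Sym → Bool
  | .endFormula => false
  | .endW => false
  | _ => true

theorem parse_bits (x : List Bool) (y : List Sym) :
    parse (x.map Sym.bit ++ y) = (x ++ (parse y).1, (parse y).2) := by
  induction x with
  | nil => rfl
  | cons b x ih => simp [parse, ih]

theorem parse_clauseWord (c : List Lit) (y : List Sym) :
    parse (clauseWord c ++ y) = ([], c.map some ++ none :: (parse y).2) := by
  induction c with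
  | nil => rfl
  | cons l c ih =>
    have : clauseWord (l :: c) ++ y =
        .sign l.pos :: (l.var.map Sym.bit ++ (clauseWord c ++ y)) := by
      simp [clauseWord, litWord]
    rw [this, parse, parse_bits, ih]
    simp

theorem parse_word (f : CNFCode) (y : List Sym) :
    parse (f.word ++ y) = ([], itemsOf f ++ (parse y).2) := by
  induction f with
  | nil => rfl
  | cons c f ih =>
    have : CNFCode.word (c :: f) ++ y = clauseWord c ++ (CNFCode.word f ++ y) := by
      simp [CNFCode.word]
    rw [this, parse_clauseWord, ih]
    simp

theorem parse_words (fs : List CNFCode) (y : List Sym) :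
    (parse (fs.flatMap CNFCode.word ++ y)).2 = itemsOf fs.flatten ++ (parse y).2 := by
  induction fs with
  | nil => rfl
  | cons f fs ih =>
    rw [List.flatMap_cons, List.append_assoc, parse_word, ih]
    simp [itemsOf_append]

theorem TheoryCode.word_eq (c : TheoryCode) :
    c.word = c.W.flatMap CNFCode.word ++ .endW ::
      (c.D.flatMap fun r => [r.1, r.2.1, r.2.2]).flatMap CNFCode.word := by
  simp [TheoryCode.word, List.flatMap_assoc]

theorem TheoryCode.parse_word (c : TheoryCode) : (parse c.word).2 = itemsOf c.clauseList := by
  rw [c.word_eq, parse_words, parse]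
  have := parse_words (c.D.flatMap fun r => [r.1, r.2.1, r.2.2]) []
  rw [List.append_nil] at this
  simp [this, parse, clauseList, formulaList, itemsOf_append]

theorem filter_clauseWord (c : List Lit) :
    (clauseWord c).filter isClauseSym = clauseWord c := by
  rw [List.filter_eq_self]
  intro s hs
  simp only [clauseWord, litWord, List.mem_append, List.mem_flatMap, List.mem_cons, List.mem_map,
    List.not_mem_nil, or_false] at hs
  rcases hs with ⟨l, _, rfl | ⟨b, _, rfl⟩⟩ | rfl <;> rfl

theorem filter_words (fs : List CNFCode) :
    (fs.flatMap CNFCode.word).filter isClauseSym = fs.flatten.flatMap clauseWord := by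
  induction fs with
  | nil => rfl
  | cons f fs ih =>
    rw [List.flatMap_cons, List.filter_append, ih, List.flatten_cons, List.flatMap_append]
    congr 1
    have : CNFCode.word f = f.flatMap clauseWord ++ [.endFormula] := rfl
    rw [this, List.filter_append]
    simp only [isClauseSym, Bool.false_eq_true, not_false_eq_true, List.filter_cons_of_neg,
      List.filter_nil, List.append_nil]
    induction f with
    | nil => rfl
    | cons c f ih' => rw [List.flatMap_cons, List.filter_append, ih' rfl, filter_clauseWord]

theorem TheoryCode.filter_word (c : TheoryCode) :
    c.word.filter isClauseSym = c.clauseList.flatMap clauseWord := by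
  rw [c.word_eq, List.filter_append, filter_words, List.filter_cons_of_neg (by simp [isClauseSym]),
    filter_words, clauseList, formulaList, List.flatten_append, List.flatMap_append]

/-- A literal is written sign first, its item code is the reversal of that word. Pushing the symbols
of clauses in reading order therefore leaves a valid stack of items, in reverse order, without any
conversion. -/
theorem codes_reverse_itemsOf (cs : List (List Lit)) :
    Item.codes (itemsOf cs).reverse = ((cs.flatMap clauseWord).map Sum.inl).reverse := by
  induction cs with
  | nil => rfl
  | cons c cs ih =>
    rw [itemsOf_cons, List.flatMap_cons, List.map_append]
    have : ∀ L L' : List Item, Item.codes (L ++ L') = Item.codes L ++ Item.codes L' := by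
      simp [Item.codes]
    rw [List.reverse_append, List.reverse_append, ← ih, List.reverse_cons, this, this,
      List.append_assoc]
    congr 1
    simp only [clauseWord, List.map_append, List.reverse_append]
    congr 1
    induction c with
    | nil => rfl
    | cons l c ih' =>
      rw [List.map_cons, List.reverse_cons, this, ih', List.flatMap_cons, List.map_append,
        List.reverse_append]
      congr 1
      simp [Item.codes, Item.code, Item.body, Item.tag, litWord, List.map_reverse]

/-! ### Recognising the words of default theories -/

/-- The positions in the word of a formula: at its beginning, at the beginning of a later clause or
of the end mark, and inside or after a literal. -/
inductive Loc
  | first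
  | next
  | lit
  deriving DecidableEq

instance : Fintype Loc := ⟨{.first, .next, .lit}, fun q => by cases q <;> simp⟩

/-- The phase after a formula: phase `0` is the part `W` of a theory, the phases `1, 2, 3` are the
components of default rules. -/
def nextPhase : Fin 4 → Fin 4
  | 0 => 0
  | 1 => 2
  | 2 => 3
  | 3 => 1

/-- A finite automaton for the words of default theories. -/
def autStep : Option (Fin 4 × Loc) → Sym → Option (Fin 4 × Loc)
  | some (p, _), .sign _ => some (p, .lit)
  | some (p, .lit), .bit _ => some (p, .lit)
  | some (p, _), .endClause => some (p, .next)
  | some (p, .first), .endFormula => some (nextPhase p, .first)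
  | some (p, .next), .endFormula => some (nextPhase p, .first)
  | some (0, .first), .endW => some (1, .first)
  | _, _ => none

/-- The words that the automaton accepts from the beginning of a formula in phase `p`. -/
inductive Rest : Fin 4 → List Sym → Prop
  | nil : Rest 1 []
  | endW {y} : Rest 1 y → Rest 0 (.endW :: y)
  | formula {p y} (f : CNFCode) : Rest (nextPhase p) y → Rest p (f.word ++ y)

theorem foldl_autStep_none (x : List Sym) : x.foldl autStep none = none := by
  induction x with
  | nil => rfl
  | cons s x ih => cases s <;> exact ih

/-- The three locations call each other, so they are treated in one induction. Inside a literal, the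
remaining word consists of the rest `b` of a name, the rest `c` of the clause and the rest `f` of
the formula. -/
theorem rest_of_foldl_autStep (x : List Sym) : ∀ p,
    (x.foldl autStep (some (p, .first)) = some (1, .first) → Rest p x) ∧
    (x.foldl autStep (some (p, .next)) = some (1, .first) →
      ∃ (f : CNFCode) (y : List Sym), x = f.word ++ y ∧ Rest (nextPhase p) y) ∧
    (x.foldl autStep (some (p, .lit)) = some (1, .first) →
      ∃ (b : List Bool) (c : List Lit) (f : CNFCode) (y : List Sym),
        x = b.map Sym.bit ++ (clauseWord c ++ (f.word ++ y)) ∧ Rest (nextPhase p) y) := by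
  induction x with
  | nil =>
    intro p
    refine ⟨fun h => ?_, fun h => ?_, fun h => ?_⟩
    · simp only [List.foldl_nil, Option.some.injEq, Prod.mk.injEq, and_true] at h
      subst h
      exact .nil
    · simp at h
    · simp at h
  | cons s x ih =>
    intro p
    -- This comes first because the location `first` behaves like `next` on all symbols except
    -- `endW`.
    have hnext : (s :: x).foldl autStep (some (p, .next)) = some (1, .first) →
        ∃ (f : CNFCode) (y : List Sym), s :: x = f.word ++ y ∧ Rest (nextPhase p) y := by
      intro h
      rw [List.foldl_cons] at h
      cases s with
      | sign b =>
        obtain ⟨b', c, f, y, rfl, hy⟩ := (ih p).2.2 h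
        exact ⟨(⟨b', b⟩ :: c) :: f, y, by simp [CNFCode.word, clauseWord, litWord], hy⟩
      | bit b => rw [show autStep (some (p, .next)) (.bit b) = none from rfl, foldl_autStep_none] at h
                 simp at h
      | endClause =>
        obtain ⟨f, y, rfl, hy⟩ := (ih p).2.1 h
        exact ⟨[] :: f, y, by simp [CNFCode.word, clauseWord], hy⟩
      | endFormula => exact ⟨[], x, rfl, (ih _).1 h⟩
      | endW => rw [show autStep (some (p, .next)) .endW = none by fin_cases p <;> rfl, foldl_autStep_none] at h
                simp at h
    refine ⟨fun h => ?_, hnext, fun h => ?_⟩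
    · by_cases hs : s = .endW
      · subst hs
        rw [List.foldl_cons] at h
        by_cases hp : p = 0
        · subst hp
          exact .endW ((ih 1).1 h)
        · have : autStep (some (p, .first)) .endW = none := by
            fin_cases p
            · exact absurd rfl hp
            all_goals rfl
          rw [this, foldl_autStep_none] at h
          simp at h
      · have : autStep (some (p, .first)) s = autStep (some (p, .next)) s := by
          cases s <;> first | rfl | exact absurd rfl hs
        rw [List.foldl_cons, this, ← List.foldl_cons] at h
        obtain ⟨f, y, hxy, hy⟩ := hnext h
        rw [hxy]
        exact .formula f hy
    · rw [List.foldl_cons] at h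
      cases s with
      | sign b =>
        obtain ⟨b', c, f, y, rfl, hy⟩ := (ih p).2.2 h
        exact ⟨[], ⟨b', b⟩ :: c, f, y, by simp [clauseWord, litWord], hy⟩
      | bit b =>
        obtain ⟨b', c, f, y, rfl, hy⟩ := (ih p).2.2 h
        exact ⟨b :: b', c, f, y, by simp, hy⟩
      | endClause =>
        obtain ⟨f, y, rfl, hy⟩ := (ih p).2.1 h
        exact ⟨[], [], f, y, by simp [clauseWord], hy⟩
      | endFormula =>
        rw [show autStep (some (p, .lit)) .endFormula = none from rfl, foldl_autStep_none] at h
        simp at h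
      | endW =>
        rw [show autStep (some (p, .lit)) .endW = none by fin_cases p <;> rfl, foldl_autStep_none] at h
        simp at h

/-- In the phases 2 and 3 a rule is unfinished, and the word begins with its two, respectively one,
missing components. -/
theorem Rest.exists_word {p : Fin 4} {x : List Sym} (h : Rest p x) :
    (p = 0 → ∃ c : TheoryCode, c.word = x) ∧
    (p = 1 → ∃ D : List (CNFCode × CNFCode × CNFCode),
      x = D.flatMap fun r => r.1.word ++ r.2.1.word ++ r.2.2.word) ∧
    (p = 2 → ∃ (f g : CNFCode) (D : List (CNFCode × CNFCode × CNFCode)),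
      x = f.word ++ (g.word ++ D.flatMap fun r => r.1.word ++ r.2.1.word ++ r.2.2.word)) ∧
    (p = 3 → ∃ (f : CNFCode) (D : List (CNFCode × CNFCode × CNFCode)),
      x = f.word ++ D.flatMap fun r => r.1.word ++ r.2.1.word ++ r.2.2.word) := by
  induction h with
  | nil => exact ⟨by simp, fun _ => ⟨[], rfl⟩, by simp, by simp⟩
  | endW _ ih =>
    obtain ⟨D, rfl⟩ := ih.2.1 rfl
    exact ⟨fun _ => ⟨⟨[], D⟩, rfl⟩, by simp, by simp, by simp⟩
  | formula f _ ih =>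
    refine ⟨?_, ?_, ?_, ?_⟩ <;> rintro rfl
    · obtain ⟨c, rfl⟩ := ih.1 rfl
      exact ⟨⟨f :: c.W, c.D⟩, by simp [TheoryCode.word]⟩
    · obtain ⟨g, h, D, rfl⟩ := ih.2.2.1 rfl
      exact ⟨(f, g, h) :: D, by simp⟩
    · obtain ⟨g, D, rfl⟩ := ih.2.2.2 rfl
      exact ⟨f, g, D, rfl⟩
    · obtain ⟨D, rfl⟩ := ih.2.1 rfl
      exact ⟨f, D, rfl⟩

theorem foldl_autStep_bits (b : List Bool) (p : Fin 4) :
    (b.map Sym.bit).foldl autStep (some (p, .lit)) = some (p, .lit) := by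
  induction b with
  | nil => rfl
  | cons a b ih => exact ih

theorem foldl_autStep_clauseWord (c : List Lit) (p : Fin 4) (q : Loc) :
    (clauseWord c).foldl autStep (some (p, q)) = some (p, .next) := by
  induction c generalizing q with
  | nil => cases q <;> rfl
  | cons l c ih =>
    have : clauseWord (l :: c) = .sign l.pos :: (l.var.map Sym.bit ++ clauseWord c) := by
      simp [clauseWord, litWord]
    have h : autStep (some (p, q)) (.sign l.pos) = some (p, .lit) := by cases q <;> rfl
    rw [this, List.foldl_cons, h, List.foldl_append, foldl_autStep_bits, ih]

theorem foldl_autStep_word (f : CNFCode) (p : Fin 4) {q : Loc} (hq : q ≠ .lit) :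
    f.word.foldl autStep (some (p, q)) = some (nextPhase p, .first) := by
  induction f generalizing q with
  | nil => cases q <;> first | rfl | exact absurd rfl hq
  | cons c f ih =>
    have : CNFCode.word (c :: f) = clauseWord c ++ CNFCode.word f := by simp [CNFCode.word]
    rw [this, List.foldl_append, foldl_autStep_clauseWord, ih (by simp)]

/-- The accepting state is the one entered after `endW` and again after each complete rule, so a
word cannot end within a rule. -/
theorem foldl_autStep_iff (x : List Sym) :
    x.foldl autStep (some (0, .first)) = some (1, .first) ↔ ∃ c : TheoryCode, c.word = x := by
  constructor
  · exact fun h => ((rest_of_foldl_autStep x 0).1 h).exists_word.1 rfl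
  · rintro ⟨⟨W, D⟩, rfl⟩
    rw [TheoryCode.word, List.foldl_append]
    have hW : (W.flatMap CNFCode.word).foldl autStep (some (0, .first)) = some (0, .first) := by
      induction W with
      | nil => rfl
      | cons f W ih =>
        rw [List.flatMap_cons, List.foldl_append, foldl_autStep_word _ _ (by simp)]
        exact ih
    rw [hW, List.foldl_cons]
    change List.foldl autStep (some (1, .first)) _ = _
    induction D with
    | nil => rfl
    | cons r D ih =>
      rw [List.flatMap_cons, List.foldl_append, List.foldl_append, List.foldl_append,
        foldl_autStep_word _ _ (by simp), foldl_autStep_word _ _ (by simp),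
        foldl_autStep_word _ _ (by simp)]
      exact ih

end DefaultLogic

namespace DefaultLogic
open Function

/-! ### Operations on stacks of items -/

/-- A state in which the auxiliary stacks are empty and the other stacks hold items. -/
structure ItemState (M I : Type) where
  mem : M
  inp : List Alpha
  st : I → List Item

namespace ItemState

variable {M I : Type}

/-- The contents of the stacks. -/
def stk (s : ItemState M I) : Stk I → List Alpha
  | .inp => s.inp
  | .tA => []
  | .tB => []
  | .item i => Item.codes (s.st i)

/-- The state of the machine. -/
def enc (s : ItemState M I) : Regs M × (Stk I → List Alpha) :=
  (⟨none, none, false, false, s.mem⟩, s.stk)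

/-- All names of variables have at most `N` bits. -/
def Bounded (N : ℕ) (s : ItemState M I) : Prop := ∀ i, ∀ it ∈ s.st i, it.body.length ≤ N

end ItemState

namespace Cmd

variable {M I : Type} [DecidableEq I]

theorem Runs.le {K G σ : Type} [DecidableEq K] {c : Cmd K G σ} {s t t' : σ × (K → List G)}
    {n m : ℕ} (h : Runs c s t n) (ht : t = t') (hn : n ≤ m) : RunsLe c s t' m :=
  ⟨n, hn, ht ▸ h⟩

/-- The program transforms one state into another one by at most `n` operations, each of which takes
linear time in the length of the names. -/
def RunsI (N : ℕ) (c : Cmd (Stk I) Alpha (Regs M)) (s s' : ItemState M I) (n : ℕ) : Prop :=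
  s.Bounded N → s'.Bounded N ∧ RunsLe c s.enc s'.enc (n * (30 * (N + 2)))

variable {N : ℕ} {c d : Cmd (Stk I) Alpha (Regs M)} {s s' s'' : ItemState M I} {m n : ℕ}

theorem RunsI.mono (h : RunsI N c s s' m) (hmn : m ≤ n) : RunsI N c s s' n := fun hs => by
  obtain ⟨h₁, t, ht, h₂⟩ := h hs
  exact ⟨h₁, t, ht.trans (Nat.mul_le_mul_right _ hmn), h₂⟩

theorem RunsI.seq (h₁ : RunsI N c s s' m) (h₂ : RunsI N d s' s'' n) :
    RunsI N (c ;; d) s s'' (m + n) := fun hs => by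
  obtain ⟨hs', t₁, ht₁, r₁⟩ := h₁ hs
  obtain ⟨hs'', t₂, ht₂, r₂⟩ := h₂ hs'
  exact ⟨hs'', t₁ + t₂, by rw [add_mul]; omega, r₁.seq r₂⟩

theorem RunsI.ite_true {p : M → Bool} (hp : p s.mem = true) (h : RunsI N c s s' n) :
    RunsI N (ite (fun r => p r.mem) c d) s s' (n + 1) := fun hs => by
  obtain ⟨hs', t, ht, r⟩ := h hs
  exact ⟨hs', 1 + t, by rw [add_mul]; omega, r.ite_true hp⟩

theorem RunsI.ite_false {p : M → Bool} (hp : p s.mem = false) (h : RunsI N d s s' n) :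
    RunsI N (ite (fun r => p r.mem) c d) s s' (n + 1) := fun hs => by
  obtain ⟨hs', t, ht, r⟩ := h hs
  exact ⟨hs', 1 + t, by rw [add_mul]; omega, r.ite_false hp⟩

theorem RunsI.loop_done {p : M → Bool} (hp : p s.mem = false) :
    RunsI N (loop (fun r => p r.mem) c) s s 1 := fun hs =>
  ⟨hs, 1, by omega, Runs.loop_done hp⟩

theorem RunsI.loop_step {p : M → Bool} (hp : p s.mem = true) (h₁ : RunsI N c s s' m)
    (h₂ : RunsI N (loop (fun r => p r.mem) c) s' s'' n) :
    RunsI N (loop (fun r => p r.mem) c) s s'' (m + n + 1) := fun hs => by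
  obtain ⟨hs', t₁, ht₁, r₁⟩ := h₁ hs
  obtain ⟨hs'', t₂, ht₂, r₂⟩ := h₂ hs'
  exact ⟨hs'', 1 + (t₁ + t₂), by rw [add_mul, add_mul]; omega, r₁.loop_step hp r₂⟩

theorem RunsI.skip : RunsI N skip s s 1 := fun hs => ⟨hs, 1, by omega, Runs.skip⟩

/-- Change the memory. -/
def act (f : M → M) : Cmd (Stk I) Alpha (Regs M) := load fun r => { r with mem := f r.mem }

/-- Read a symbol of the input. -/
def popInp (f : M → Option Alpha → M) : Cmd (Stk I) Alpha (Regs M) :=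
  pop .inp fun r o => { r with mem := f r.mem o }

/-- Move an item from stack `a` to stack `b`. -/
def move (a b : I) : Cmd (Stk I) Alpha (Regs M) := pull (.item a) .tA ;; pour .tA (.item b)

/-- Copy an item from stack `a` to stack `b`. -/
def copy (a b : I) : Cmd (Stk I) Alpha (Regs M) :=
  pull (.item a) .tA ;; pourTwo .tA (.item a) (.item b)

/-- Remove an item. -/
def drop (a : I) : Cmd (Stk I) Alpha (Regs M) := pull (.item a) .tA ;; clear .tA

/-- Inspect the tag of an item. -/
def look (a : I) (f : M → Option Alpha → M) : Cmd (Stk I) Alpha (Regs M) :=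
  pull (.item a) .tA ;; load (fun r => { r with mem := f r.mem r.x }) ;; pour .tA (.item a)

/-- Compare the topmost items of two stacks, up to the map `ν` on symbols. -/
def compare (ν : Alpha → Alpha) (a b : I) (f : M → Bool → M) : Cmd (Stk I) Alpha (Regs M) :=
  pull (.item a) .tA ;; pull (.item b) .tB ;; zipBack ν (.item a) (.item b) ;;
    load (fun r => { r with eq := false, mem := f r.mem r.eq })

theorem runsI_act (f : M → M) : RunsI N (act f) s ⟨f s.mem, s.inp, s.st⟩ 1 := fun hs =>
  ⟨hs, 1, by omega, Runs.load⟩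

theorem runsI_popInp (f : M → Option Alpha → M) :
    RunsI N (popInp f) s ⟨f s.mem s.inp.head?, s.inp.tail, s.st⟩ 1 := fun hs =>
  ⟨hs, Runs.le Runs.pop (Prod.ext rfl (by
    funext k
    cases k <;> simp [ItemState.stk, ItemState.enc])) (by omega)⟩

theorem runs_pull_item {a : I} {t : Stk I} (hat : .item a ≠ t) {r : Regs M}
    {S : Stk I → List Alpha} {it : Item} {L : List Item}
    (h : S (.item a) = Item.codes (it :: L)) :
    Runs (pull (.item a) t) (r, S) ({ r with x := some it.tag, go := false },
      update (update S (.item a) (Item.codes L)) t (it.tag :: (it.body.reverse ++ S t)))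
      (4 * it.body.length + 6) :=
  runs_pull hat (by rw [h, Item.codes_cons]) (fun _ => Item.isTag_of_mem_body) it.isTag_tag

/-- Stack `b` is read after the removal from `a`, which keeps the formula right even for `a = b`. -/
theorem runsI_move {a b : I} {it : Item} {L : List Item} (h : s.st a = it :: L) :
    RunsI N (move a b) s
      ⟨s.mem, s.inp, update (update s.st a L) b (it :: update s.st a L b)⟩ 1 := fun hs => by
  have hit := hs a it (by simp [h])
  refine ⟨fun i it' hi => ?_, Runs.le (Runs.seq (runs_pull_item (it := it) (L := L) (by simp)
    (congrArg Item.codes h)) (runs_pour (by simp) _ _)) (Prod.ext rfl ?_) ?_⟩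
  · simp only [update_apply] at hi
    have := hs i it'
    have := hs b it'
    have := hs a it'
    grind
  · funext k
    cases k with
    | item i =>
      simp only [ItemState.enc, ItemState.stk, update_apply, Stk.item.injEq]
      split_ifs <;> simp_all [Item.codes_cons]
    | _ => simp [ItemState.enc, ItemState.stk, update_apply]
  · simp [ItemState.stk]
    omega

theorem runsI_copy {a b : I} (hab : a ≠ b) {it : Item} {L : List Item} (h : s.st a = it :: L) :
    RunsI N (copy a b) s ⟨s.mem, s.inp, update s.st b (it :: s.st b)⟩ 1 := fun hs => by
  have hit := hs a it (by simp [h])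
  refine ⟨fun i it' hi => ?_, Runs.le (Runs.seq (runs_pull_item (it := it) (L := L) (by simp)
    (congrArg Item.codes h)) (runs_pourTwo (by simp) (by simp) (by simpa) _ _))
    (Prod.ext rfl ?_) ?_⟩
  · simp only [update_apply] at hi
    have := hs i it'
    have := hs b it'
    grind
  · funext k
    cases k with
    | item i =>
      simp only [ItemState.enc, ItemState.stk, update_apply, Stk.item.injEq]
      split_ifs <;> simp_all [Item.codes_cons]
    | _ => simp [ItemState.enc, ItemState.stk, update_apply]
  · simp [ItemState.stk]
    omega

theorem runsI_drop {a : I} : RunsI N (drop a) s ⟨s.mem, s.inp, update s.st a (s.st a).tail⟩ 1 :=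
    fun hs => by
  refine ⟨fun i it' hi => ?_, ?_⟩
  · simp only [update_apply] at hi
    split_ifs at hi with h
    · exact hs a it' (List.mem_of_mem_tail hi)
    · exact hs i it' hi
  cases h : s.st a with
  | nil =>
    refine Runs.le (Runs.seq (runs_pull_empty (by simp)
      (congrArg Item.codes h)) (runs_clear _ _ _))
      (Prod.ext rfl ?_) ?_
    · funext k
      cases k with
      | item i =>
        simp only [ItemState.enc, ItemState.stk, update_apply]
        split_ifs <;> simp_all
      | _ => simp [ItemState.enc, ItemState.stk]
    · simp [ItemState.stk]
      omega
  | cons it L =>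
    have hit := hs a it (by simp [h])
    refine Runs.le (Runs.seq (runs_pull_item (it := it) (L := L) (by simp)
    (congrArg Item.codes h)) (runs_clear _ _ _)) (Prod.ext rfl ?_) ?_
    · funext k
      cases k with
      | item i =>
        simp only [ItemState.enc, ItemState.stk, update_apply, Stk.item.injEq]
        split_ifs <;> simp_all
      | _ => simp [ItemState.enc, ItemState.stk]
    · simp [ItemState.stk]
      omega

theorem runsI_look {a : I} (f : M → Option Alpha → M) :
    RunsI N (look a f) s ⟨f s.mem ((s.st a).head?.map Item.tag), s.inp, s.st⟩ 1 := fun hs => by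
  refine ⟨hs, ?_⟩
  cases h : s.st a with
  | nil =>
    refine Runs.le (Runs.seq (runs_pull_empty (by simp)
      (congrArg Item.codes h)) (Runs.seq Runs.load
      (runs_pour (by simp) _ _))) (Prod.ext rfl ?_) ?_
    · funext k
      cases k with
      | item i =>
        simp only [ItemState.enc, ItemState.stk, update_apply]
        split_ifs <;> simp_all
      | _ => simp [ItemState.enc, ItemState.stk]
    · simp [ItemState.stk]
      omega
  | cons it L =>
    have hit := hs a it (by simp [h])
    refine Runs.le (Runs.seq (runs_pull_item (it := it) (L := L) (by simp)
    (congrArg Item.codes h)) (Runs.seq Runs.load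
      (runs_pour (by simp) _ _))) (Prod.ext rfl ?_) ?_
    · funext k
      cases k with
      | item i =>
        simp only [ItemState.enc, ItemState.stk, update_apply, Stk.item.injEq]
        split_ifs <;> simp_all [Item.codes_cons]
      | _ => simp [ItemState.enc, ItemState.stk]
    · simp [ItemState.stk]
      omega

/-- Both items return to their places. The two pulls, the parallel comparison and the `load` take at
most `22 * N + 36` steps, which fits into the unit `30 * (N + 2)` of `RunsI`. -/
theorem runsI_compare {ν : Alpha → Alpha} {a b : I} (hab : a ≠ b) (f : M → Bool → M) {it it' : Item}
    {L L' : List Item} (h : s.st a = it :: L) (h' : s.st b = it' :: L') :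
    RunsI N (compare ν a b f) s ⟨f s.mem (decide ((it.tag :: it.body.reverse).map ν =
      (it'.tag :: it'.body.reverse).map ν)), s.inp, s.st⟩ 1 := fun hs => by
  have hit := hs a it (by simp [h])
  have hit' := hs b it' (by simp [h'])
  refine ⟨hs, ?_⟩
  have h₁ := runs_pull_item (t := .tA) (by simp) (r := s.enc.1) (S := s.enc.2) (a := a)
    (congrArg Item.codes h)
  have h₂ := (runs_pull_item (t := .tB) (by simp) (r := { s.enc.1 with x := some it.tag, go := false })
    (S := update (update s.enc.2 (.item a) (Item.codes L)) .tA
      (it.tag :: (it.body.reverse ++ s.enc.2 .tA))) (a := b) (it := it') (L := L')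
    (by simp [ItemState.enc, ItemState.stk, h', hab.symm]))
  have h₃ := runs_zipBack (ν := ν) hab { s.enc.1 with x := some it'.tag, go := false }
    (update (update (update (update s.enc.2 (.item a) (Item.codes L)) .tA
      (it.tag :: (it.body.reverse ++ s.enc.2 .tA))) (.item b) (Item.codes L')) .tB
      (it'.tag :: (it'.body.reverse ++ s.enc.2 .tB)))
  obtain ⟨t, ht, h₃⟩ := h₃
  refine Runs.le (Runs.seq h₁ (Runs.seq h₂ (Runs.seq h₃ Runs.load))) (Prod.ext ?_ ?_) ?_
  · simp [ItemState.enc, ItemState.stk]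
  · funext k
    cases k with
    | item i =>
      simp only [ItemState.enc, ItemState.stk, update_apply, Stk.item.injEq]
      split_ifs <;> simp_all [Item.codes_cons]
    | _ => simp [ItemState.enc, ItemState.stk, update_apply]
  · simp [ItemState.enc, ItemState.stk] at ht
    omega

/-- The map on symbols that forgets the signs of literals. -/
def forgetSign : Alpha → Alpha
  | .inl (.sign _) => .inl (.sign true)
  | g => g

theorem compare_id_iff (l l' : Lit) : (Item.tag (some l) :: (Item.body (some l)).reverse).map id =
    (Item.tag (some l') :: (Item.body (some l')).reverse).map id ↔ l = l' := by
  obtain ⟨x, b⟩ := l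
  obtain ⟨x', b'⟩ := l'
  have : Injective fun b : Bool => (Sum.inl (Sym.bit b) : Alpha) := fun b b' h => by simpa using h
  simp [Item.tag, Item.body, List.map_reverse, this.list_map.eq_iff, and_comm]

theorem compare_forgetSign_iff (l l' : Lit) :
    (Item.tag (some l) :: (Item.body (some l)).reverse).map forgetSign =
    (Item.tag (some l') :: (Item.body (some l')).reverse).map forgetSign ↔ l.var = l'.var := by
  have : Injective fun b : Bool => (Sum.inl (Sym.bit b) : Alpha) := fun b b' h => by simpa using h
  simp [Item.tag, Item.body, forgetSign, List.map_reverse, comp_def, this.list_map.eq_iff]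

end Cmd

/-! ### The search program -/

/-- The memory of the search program: the tag that was seen last, the result of comparisons, whether
a heavy clause was found, whether the input is accepted, the weight of the collected literals, the
current symbol of the input, and the state of the automaton. -/
structure Mem where
  t : Option Alpha
  hit : Bool
  fnd : Bool
  acc : Bool
  w : Fin 8
  sym : Option Alpha
  aut : Option (Fin 4 × Loc)

instance : Fintype Mem :=
  Fintype.ofEquiv (Option Alpha × Bool × Bool × Bool × Fin 8 × Option Alpha × Option (Fin 4 × Loc))
    { toFun := fun r => ⟨r.1, r.2.1, r.2.2.1, r.2.2.2.1, r.2.2.2.2.1, r.2.2.2.2.2.1, r.2.2.2.2.2.2⟩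
      invFun := fun m => (m.t, m.hit, m.fnd, m.acc, m.w, m.sym, m.aut)
      left_inv := fun _ => rfl
      right_inv := fun _ => rfl }

/-- The stacks of items: the current list of items, the original one (in reverse order), the
collected literals, and two auxiliary stacks. -/
inductive Slot
  | cur
  | orig
  | aux
  | found
  | aux'
  deriving DecidableEq

instance : Fintype Slot :=
  ⟨{.cur, .orig, .aux, .found, .aux'}, fun i => by cases i <;> simp⟩

/-- The stacks of items. -/
@[simp] def slots (T O U V X : List Item) : Slot → List Item
  | .cur => T
  | .orig => O
  | .aux => U
  | .found => V
  | .aux' => X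

section

variable (T O U V X L : List Item)

@[simp] theorem update_slots_cur : update (slots T O U V X) .cur L = slots L O U V X := by
  funext i; cases i <;> simp

@[simp] theorem update_slots_orig : update (slots T O U V X) .orig L = slots T L U V X := by
  funext i; cases i <;> simp

@[simp] theorem update_slots_aux : update (slots T O U V X) .aux L = slots T O L V X := by
  funext i; cases i <;> simp

@[simp] theorem update_slots_found : update (slots T O U V X) .found L = slots T O U L X := by
  funext i; cases i <;> simp

@[simp] theorem update_slots_aux' : update (slots T O U V X) .aux' L = slots T O U V L := by
  funext i; cases i <;> simp

end

namespace Cmd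

variable {N : ℕ} {s s' s'' : ItemState Mem Slot} {m n : ℕ} {p : Mem → Bool}
  {a b : Slot} {c d : Cmd (Stk Slot) Alpha (Regs Mem)}

theorem RunsI.congr (h : RunsI N c s s' n) (hs : s' = s'') : RunsI N c s s'' n := hs ▸ h

/-- Inspect the topmost item of a stack. -/
def see (a : Slot) : Cmd (Stk Slot) Alpha (Regs Mem) := look a fun m o => { m with t := o }

/-- The effect of `see`. -/
def seen (a : Slot) (s : ItemState Mem Slot) : ItemState Mem Slot :=
  ⟨{ s.mem with t := (s.st a).head?.map Item.tag }, s.inp, s.st⟩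

theorem runsI_see : RunsI N (see a) s (seen a s) 1 := runsI_look _

/-- Repeat `c` while `p` is true of the memory, with the tag of the topmost item of `a`. -/
def scan (p : Mem → Bool) (a : Slot) (c : Cmd (Stk Slot) Alpha (Regs Mem)) :
    Cmd (Stk Slot) Alpha (Regs Mem) :=
  see a ;; loop (fun r => p r.mem) (c ;; see a)

/-- The loop of `scan`, after the first inspection. -/
def ScanLoop (N : ℕ) (p : Mem → Bool) (a : Slot) (c : Cmd (Stk Slot) Alpha (Regs Mem))
    (s s' : ItemState Mem Slot) (n : ℕ) : Prop :=
  RunsI N (loop (fun r => p r.mem) (c ;; see a)) (seen a s) s' n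

theorem ScanLoop.done (h : p (seen a s).mem = false) : ScanLoop N p a c s (seen a s) 1 :=
  RunsI.loop_done h

theorem ScanLoop.step (h : p (seen a s).mem = true) (h₁ : RunsI N c (seen a s) s' m)
    (h₂ : ScanLoop N p a c s' s'' n) : ScanLoop N p a c s s'' (m + n + 2) :=
  (RunsI.loop_step h (h₁.seq runsI_see) h₂).mono (by omega)

theorem ScanLoop.mono (h : ScanLoop N p a c s s' m) (hmn : m ≤ n) : ScanLoop N p a c s s' n :=
  RunsI.mono h hmn

theorem ScanLoop.congr (h : ScanLoop N p a c s s' n) (hs : s' = s'') : ScanLoop N p a c s s'' n :=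
  hs ▸ h

theorem ScanLoop.runsI (h : ScanLoop N p a c s s' n) : RunsI N (scan p a c) s s' (n + 1) :=
  (runsI_see.seq h).mono (by omega)

/-- There is an item to be processed. -/
def more (m : Mem) : Bool := m.t.isSome

/-- Remove all items from a stack. -/
def empty (a : Slot) : Cmd (Stk Slot) Alpha (Regs Mem) := scan more a (drop a)

theorem runsI_empty (a : Slot) (s : ItemState Mem Slot) :
    RunsI N (empty a) s ⟨{ s.mem with t := none }, s.inp, update s.st a []⟩
      (3 * (s.st a).length + 2) := by
  have key : ∀ (L : List Item) (s : ItemState Mem Slot), s.st a = L →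
      ScanLoop N more a (drop a) s ⟨{ s.mem with t := none }, s.inp, update s.st a []⟩
        (3 * L.length + 1) := by
    intro L
    induction L with
    | nil =>
      intro s h
      exact (ScanLoop.done (by simp [seen, more, h])).congr (by
        rw [seen, ← h, update_eq_self, h]; rfl)
    | cons it L ih =>
      intro s h
      have h₁ := runsI_drop (N := N) (s := seen a s) (a := a)
      exact ((ScanLoop.step (by simp [seen, more, h]) h₁ (ih _ (by simp [seen, h]))).mono (by
        simp only [List.length_cons]; omega)).congr (by simp [seen])
  exact (key _ s rfl).runsI

/-- Move all items of a stack to another one. -/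
def rewind (a b : Slot) : Cmd (Stk Slot) Alpha (Regs Mem) := scan more a (move a b)

theorem runsI_rewind (hab : a ≠ b) (s : ItemState Mem Slot) :
    RunsI N (rewind a b) s ⟨{ s.mem with t := none }, s.inp,
      update (update s.st a []) b ((s.st a).reverse ++ s.st b)⟩ (3 * (s.st a).length + 2) := by
  have key : ∀ (L : List Item) (s : ItemState Mem Slot), s.st a = L →
      ScanLoop N more a (move a b) s ⟨{ s.mem with t := none }, s.inp,
        update (update s.st a []) b (L.reverse ++ s.st b)⟩ (3 * L.length + 1) := by
    intro L
    induction L with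
    | nil =>
      intro s h
      exact (ScanLoop.done (by simp [seen, more, h])).congr (by
        rw [seen, ← h, update_eq_self, h]; simp)
    | cons it L ih =>
      intro s h
      have h₁ := runsI_move (N := N) (s := seen a s) (a := a) (b := b) (it := it) (L := L) h
      refine ((ScanLoop.step (by simp [seen, more, h]) h₁ (ih _ (by simp [hab]))).mono (by
        simp only [List.length_cons]; omega)).congr ?_
      simp only [seen, ItemState.mk.injEq, true_and]
      funext i
      simp only [update_apply]
      split_ifs <;> simp_all
  exact (key _ s rfl).runsI

/-- Test whether the topmost literal of the current list is among the collected ones. -/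
def testMem : Cmd (Stk Slot) Alpha (Regs Mem) :=
  act (fun m => { m with hit := false }) ;;
    scan more .found
      (compare id .cur .found (fun m b => { m with hit := m.hit || b }) ;; move .found .aux') ;;
    rewind .aux' .found

/-- The collected literals travel to `aux'` and back, so their order, to which the branch symbols
refer, is preserved. -/
theorem runsI_testMem (m : Mem) (inp : List Alpha) (l : Lit) (v : List Lit) (T O U : List Item) :
    RunsI N testMem ⟨m, inp, slots (some l :: T) O U (v.map some) []⟩
      ⟨{ m with t := none, hit := decide (l ∈ v) }, inp, slots (some l :: T) O U (v.map some) []⟩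
      (7 * v.length + 5) := by
  have key : ∀ (v : List Lit) (m : Mem) (X : List Item),
      ScanLoop N more .found
        (compare id .cur .found (fun m b => { m with hit := m.hit || b }) ;; move .found .aux')
        ⟨m, inp, slots (some l :: T) O U (v.map some) X⟩
        ⟨{ m with t := none, hit := m.hit || decide (l ∈ v) }, inp,
          slots (some l :: T) O U [] ((v.map some).reverse ++ X)⟩
        (4 * v.length + 1) := by
    intro v
    induction v with
    | nil =>
      intro m X
      exact (ScanLoop.done (by simp [seen, more])).congr (by simp [seen])
    | cons l' v ih =>
      intro m X
      have h₁ := runsI_compare (N := N) (ν := id) (a := .cur) (b := .found) (by simp)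
        (fun m b => { m with hit := m.hit || b })
        (s := seen .found ⟨m, inp, slots (some l :: T) O U ((l' :: v).map some) X⟩)
        (it := some l) (it' := some l') rfl rfl
      have h₂ := runsI_move (N := N) (a := .found) (b := .aux') (it := some l')
        (L := v.map some) (s := ⟨{ m with
          t := some (Item.tag (some l'))
          hit := m.hit || decide (l = l') }, inp,
          slots (some l :: T) O U ((l' :: v).map some) X⟩) rfl
      simp only [compare_id_iff] at h₁
      simp only [slots, update_slots_found, update_slots_aux'] at h₂
      refine ((ScanLoop.step (by simp [seen, more]) (h₁.seq h₂)
        (ih _ (some l' :: X))).mono ?_).congr ?_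
      · simp only [List.length_cons]
        omega
      · simp [Bool.or_assoc]
  have h₁ := runsI_act (N := N) (s := ⟨m, inp, slots (some l :: T) O U (v.map some) []⟩)
    (fun m => { m with hit := false })
  have h₂ := (key v { m with hit := false } []).runsI
  have h₃ := runsI_rewind (N := N) (a := .aux') (b := .found) (by simp)
    ⟨{ m with t := none, hit := decide (l ∈ v) }, inp,
      slots (some l :: T) O U [] ((v.map some).reverse)⟩
  simp only [Bool.false_or, List.append_nil] at h₂
  refine ((h₁.seq (h₂.seq h₃)).mono ?_).congr ?_
  · simp
    omega
  · simp

/-- The weight of a literal, in terms of its tag. -/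
def tagWeight (wt : Bool → ℕ) : Option Alpha → ℕ
  | some (.inl (.sign b)) => wt b
  | _ => 0

/-- Process one item during the search for a heavy clause. -/
def findStep (wt : Bool → ℕ) (thr : ℕ) : Cmd (Stk Slot) Alpha (Regs Mem) :=
  ite (fun r => decide (r.mem.t = some (.inl .endClause)))
    (empty .found ;; act (fun m => { m with w := 0 }))
    (testMem ;; see .cur ;;
      ite (fun r => r.mem.hit || decide (tagWeight wt r.mem.t = 0))
        (act fun m => { m with hit := false })
        (copy .cur .found ;; act fun m => { m with
          hit := false
          fnd := decide (thr ≤ tagWeight wt m.t + m.w.val)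
          w := Fin.ofNat 8 (tagWeight wt m.t + m.w.val) })) ;;
  move .cur .aux

/-- Search for a heavy clause, collecting literals. -/
def find (wt : Bool → ℕ) (thr : ℕ) : Cmd (Stk Slot) Alpha (Regs Mem) :=
  scan (fun m => m.t.isSome && !m.fnd) .cur (findStep wt thr) ;; rewind .aux .cur

theorem runsI_findStep_none (wt : Bool → ℕ) (thr : ℕ) (m : Mem) (inp : List Alpha)
    (T O U V : List Item) :
    RunsI N (findStep wt thr) (seen .cur ⟨m, inp, slots (none :: T) O U V []⟩)
      ⟨{ m with t := none, w := 0 }, inp, slots T O (none :: U) [] []⟩ (3 * V.length + 5) := by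
  have h₁ := runsI_empty (N := N) .found (seen .cur ⟨m, inp, slots (none :: T) O U V []⟩)
  have h₂ := runsI_act (N := N) (s := ⟨{ m with t := none }, inp, slots (none :: T) O U [] []⟩)
    (fun m => { m with w := 0 })
  have h₃ := runsI_move (N := N) (a := .cur) (b := .aux) (it := none) (L := T)
    (s := ⟨{ m with t := none, w := 0 }, inp, slots (none :: T) O U [] []⟩) rfl
  simp only [seen, update_slots_found] at h₁
  refine (((RunsI.ite_true (p := fun m => decide (m.t = some (.inl .endClause))) rfl
    (h₁.seq h₂)).seq h₃).mono ?_).congr ?_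
  · simp
  · simp

/-- The membership test overwrites the tag, hence the second inspection of `cur` before the weight
is consulted. The flag `hit` is false before and after, so the step can be iterated. -/
theorem runsI_findStep_some (wt : Bool → ℕ) (thr : ℕ) (m : Mem) (inp : List Alpha) (l : Lit)
    (v : List Lit) (T O U : List Item) (hm : m.hit = false) :
    RunsI N (findStep wt thr) (seen .cur ⟨m, inp, slots (some l :: T) O U (v.map some) []⟩)
      (if l ∈ v ∨ wt l.pos = 0 then
        ⟨{ m with t := some (Item.tag (some l)) }, inp, slots T O (some l :: U) (v.map some) []⟩
      else
        ⟨{ m with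
            t := some (Item.tag (some l))
            fnd := decide (thr ≤ wt l.pos + m.w.val)
            w := Fin.ofNat 8 (wt l.pos + m.w.val) }, inp,
          slots T O (some l :: U) ((l :: v).map some) []⟩) (7 * v.length + 12) := by
  have h₁ := runsI_testMem (N := N) { m with t := some (Item.tag (some l)) } inp l v T O U
  have h₂ := runsI_see (N := N) (a := .cur) (s := ⟨{ m with t := none, hit := decide (l ∈ v) }, inp,
    slots (some l :: T) O U (v.map some) []⟩)
  by_cases h : l ∈ v ∨ wt l.pos = 0
  · have h₃ := runsI_act (N := N) (s := ⟨{ m with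
      t := some (Item.tag (some l))
      hit := decide (l ∈ v) }, inp, slots (some l :: T) O U (v.map some) []⟩)
      (fun m => { m with hit := false })
    have h₄ := runsI_move (N := N) (a := .cur) (b := .aux) (it := some l) (L := T)
      (s := ⟨{ m with t := some (Item.tag (some l)), hit := false }, inp,
        slots (some l :: T) O U (v.map some) []⟩) rfl
    refine (((RunsI.ite_false (p := fun m => decide (m.t = some (.inl .endClause))) rfl
      (h₁.seq (h₂.seq (RunsI.ite_true
        (p := fun m => m.hit || decide (tagWeight wt m.t = 0)) ?_ h₃)))).seq h₄).mono ?_).congr ?_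
    · change (decide (l ∈ v) || decide (wt l.pos = 0)) = true
      simpa using h
    · omega
    · simp [h, ← hm]
  · have h₃ := runsI_copy (N := N) (a := .cur) (b := .found) (by simp) (it := some l) (L := T)
      (s := ⟨{ m with t := some (Item.tag (some l)), hit := decide (l ∈ v) }, inp,
        slots (some l :: T) O U (v.map some) []⟩) rfl
    have h₄ := runsI_act (N := N) (s := ⟨{ m with
        t := some (Item.tag (some l))
        hit := decide (l ∈ v) }, inp, slots (some l :: T) O U ((l :: v).map some) []⟩)
      (fun m => { m with
          hit := false
          fnd := decide (thr ≤ tagWeight wt m.t + m.w.val)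
          w := Fin.ofNat 8 (tagWeight wt m.t + m.w.val) })
    have h₅ := runsI_move (N := N) (a := .cur) (b := .aux) (it := some l) (L := T)
      (s := ⟨{ m with
          t := some (Item.tag (some l))
          hit := false
          fnd := decide (thr ≤ wt l.pos + m.w.val)
          w := Fin.ofNat 8 (wt l.pos + m.w.val) }, inp,
        slots (some l :: T) O U ((l :: v).map some) []⟩) rfl
    simp only [slots, update_slots_found] at h₃
    refine (((RunsI.ite_false (p := fun m => decide (m.t = some (.inl .endClause))) rfl
      (h₁.seq (h₂.seq (RunsI.ite_false
        (p := fun m => m.hit || decide (tagWeight wt m.t = 0)) ?_ (h₃.seq h₄))))).seq h₅).mono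
        ?_).congr ?_
    · change (decide (l ∈ v) || decide (wt l.pos = 0)) = false
      simpa using h
    · omega
    · simp [h, ← hm]

/-- Two invariants carry the induction: the processed items lie reversed on `aux`, so that nothing
is lost, and `v.length + T.length ≤ K`, so that every item costs at most `7 * K + 15`. What is left
in `found` matters only when a heavy clause was detected. -/
theorem scanLoop_find {wt : Bool → ℕ} {thr : ℕ} (hwt : ∀ b, wt b ≤ 2) (hthr : thr ≤ 3)
    (inp : List Alpha) (O : List Item) (K : ℕ) (T : List Item) :
    ∀ (m : Mem) (v : List Lit) (U : List Item), m.hit = false → m.fnd = false →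
      m.w.val = weight wt v → weight wt v < thr → 0 < thr → v.length + T.length ≤ K →
      ∃ (t : Option Alpha) (w : Fin 8) (T' U' : List Item) (v' : List Lit),
        U'.reverse ++ T' = U.reverse ++ T ∧ v'.length ≤ K ∧
        (∀ v'', findBad wt thr v T = some v'' → v' = v'') ∧
        ScanLoop N (fun m => m.t.isSome && !m.fnd) .cur (findStep wt thr)
          ⟨m, inp, slots T O U (v.map some) []⟩
          ⟨{ m with t := t, w := w, fnd := (findBad wt thr v T).isSome }, inp,
            slots T' O U' (v'.map some) []⟩ (T.length * (7 * K + 15) + 2) := by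
  induction T with
  | nil =>
    intro m v U hm hf hw hv h₀ hK
    refine ⟨none, m.w, [], U, v, rfl, by simpa using hK, by simp [findBad],
      ((ScanLoop.done (by simp [seen])).mono (by omega)).congr ?_⟩
    simp [seen, findBad, ← hf]
  | cons it T ih =>
    intro m v U hm hf hw hv h₀ hK
    have hp : ((seen .cur ⟨m, inp, slots (it :: T) O U (v.map some) []⟩).mem.t.isSome &&
        !(seen .cur ⟨m, inp, slots (it :: T) O U (v.map some) []⟩).mem.fnd) = true := by
      simp [seen, hf]
    rw [List.length_cons] at hK
    have hlen : (it :: T).length * (7 * K + 15) + 2 = T.length * (7 * K + 15) + 2 + (7 * K + 15) := by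
      rw [List.length_cons]; ring
    cases it with
    | none =>
      obtain ⟨t, w, T', U', v', h₁, h₂, h₃, h₄⟩ := ih { m with t := none, w := 0 } [] (none :: U)
        hm hf rfl h₀ h₀ (by simp; omega)
      have h₅ := runsI_findStep_none (N := N) wt thr m inp T O U (v.map some)
      refine ⟨t, w, T', U', v', by simp [h₁], h₂, h₃, (ScanLoop.step hp h₅ h₄).mono ?_⟩
      rw [hlen, List.length_map]
      omega
    | some l =>
      have h₅ := runsI_findStep_some (N := N) wt thr m inp l v T O U hm
      have hwt' := hwt l.pos
      -- The sum is at most 2 + 2, so the counter modulo 8 never wraps.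
      have hmod : (wt l.pos + weight wt v) % 8 = wt l.pos + weight wt v :=
        Nat.mod_eq_of_lt (by omega)
      split_ifs at h₅ with h
      · obtain ⟨t, w, T', U', v', h₁, h₂, h₃, h₄⟩ := ih { m with t := some (Item.tag (some l)) } v
          (some l :: U) hm hf hw hv h₀ (by omega)
        have hfb : findBad wt thr v (some l :: T) = findBad wt thr v T := by
          rw [findBad, if_pos h]
        rw [hfb]
        refine ⟨t, w, T', U', v', by simp [h₁], h₂, h₃, (ScanLoop.step hp h₅ h₄).mono ?_⟩
        omega
      · by_cases h' : thr ≤ weight wt (l :: v)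
        · have hfb : findBad wt thr v (some l :: T) = some (l :: v) := by
            rw [findBad, if_neg h, if_pos h']
          rw [hfb]
          have h'' : thr ≤ wt l.pos + m.w.val := by
            rw [hw]; simpa [weight] using h'
          refine ⟨T.head?.map Item.tag, Fin.ofNat 8 (wt l.pos + m.w.val), T, some l :: U, l :: v,
            by simp, by simp; omega, by simp,
            ((ScanLoop.step hp h₅ (ScanLoop.done ?_)).mono ?_).congr ?_⟩
          · simp [seen, h'']
          · omega
          · simp [seen, h'']
        · have hfb : findBad wt thr v (some l :: T) = findBad wt thr (l :: v) T := by
            rw [findBad, if_neg h, if_neg h']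
          rw [hfb]
          have h'' : ¬ thr ≤ wt l.pos + m.w.val := by
            rw [hw]; simpa [weight] using h'
          obtain ⟨t, w, T', U', v', h₁, h₂, h₃, h₄⟩ := ih { m with
              t := some (Item.tag (some l))
              fnd := decide (thr ≤ wt l.pos + m.w.val)
              w := Fin.ofNat 8 (wt l.pos + m.w.val) } (l :: v)
            (some l :: U) hm (by simpa using h'') (by
              rw [Fin.val_ofNat, hw, hmod]; simp [weight]) (not_le.1 h') h₀
            (by simp; omega)
          refine ⟨t, w, T', U', v', by simp [h₁], h₂, h₃, (ScanLoop.step hp h₅ h₄).mono ?_⟩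
          omega

theorem exists_runsI_find {wt : Bool → ℕ} {thr : ℕ} (hwt : ∀ b, wt b ≤ 2) (hthr : thr ≤ 3)
    (h₀ : 0 < thr) (inp : List Alpha) (O T : List Item) {m : Mem} (hm : m.hit = false)
    (hf : m.fnd = false) (hw : m.w = 0) :
    ∃ (w : Fin 8) (v' : List Lit), v'.length ≤ T.length ∧
      (∀ v'', findBad wt thr [] T = some v'' → v' = v'') ∧
      RunsI N (find wt thr) ⟨m, inp, slots T O [] [] []⟩
        ⟨{ m with t := none, w := w, fnd := (findBad wt thr [] T).isSome }, inp,
          slots T O [] (v'.map some) []⟩ (T.length * (7 * T.length + 18) + 5) := by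
  obtain ⟨t, w, T', U', v', h₁, h₂, h₃, h₄⟩ := scanLoop_find (N := N) hwt hthr inp O T.length T m []
    [] hm hf (by simp [hw, weight]) (by simpa [weight] using h₀) h₀ (by simp)
  refine ⟨w, v', h₂, h₃, ((h₄.runsI.seq (runsI_rewind (by simp) _)).mono ?_).congr ?_⟩
  · have : U'.length ≤ T.length := by
      have := congrArg List.length h₁
      simp at this
      omega
    simp only [slots]
    have e : T.length * (7 * T.length + 18) = T.length * (7 * T.length + 15) + 3 * T.length := by
      ring
    omega
  · simp only [List.reverse_nil, List.nil_append] at h₁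
    simp [h₁]

end Cmd

/-! ### Deleting a variable, restarting, and the rounds of the search -/

namespace Cmd

variable {N : ℕ}

/-- Delete the variable of the topmost collected literal from the current list. -/
def deleteVar : Cmd (Stk Slot) Alpha (Regs Mem) :=
  scan more .cur
    (ite (fun r => decide (r.mem.t = some (.inl .endClause)))
      (move .cur .aux)
      (compare forgetSign .cur .found (fun m b => { m with hit := b }) ;;
        ite (fun r => r.mem.hit) (drop .cur) (move .cur .aux) ;;
        act fun m => { m with hit := false })) ;;
    rewind .aux .cur

/-- Comparing up to signs catches both literals of the variable; end marks have no name and are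
moved without a comparison. -/
theorem runsI_deleteVar (m : Mem) (hm : m.hit = false) (inp : List Alpha) (l : Lit)
    (T O V : List Item) :
    RunsI N deleteVar ⟨m, inp, slots T O [] (some l :: V) []⟩
      ⟨{ m with t := none }, inp, slots (delVar l.var T) O [] (some l :: V) []⟩
      (10 * T.length + 4) := by
  have key : ∀ (T : List Item) (m : Mem) (U : List Item), m.hit = false →
      ScanLoop N more .cur
        (ite (fun r => decide (r.mem.t = some (.inl .endClause)))
          (move .cur .aux)
          (compare forgetSign .cur .found (fun m b => { m with hit := b }) ;;
            ite (fun r => r.mem.hit) (drop .cur) (move .cur .aux) ;;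
            act fun m => { m with hit := false }))
        ⟨m, inp, slots T O U (some l :: V) []⟩
        ⟨{ m with t := none }, inp, slots [] O ((delVar l.var T).reverse ++ U) (some l :: V) []⟩
        (7 * T.length + 1) := by
    intro T
    induction T with
    | nil =>
      intro m U hm
      exact (ScanLoop.done (by simp [seen, more])).congr (by simp [seen, delVar])
    | cons it T ih =>
      intro m U hm
      cases it with
      | none =>
        have h₁ := runsI_move (N := N) (a := .cur) (b := .aux) (it := none) (L := T)
          (s := ⟨{ m with t := some (Item.tag none) }, inp,
            slots (none :: T) O U (some l :: V) []⟩) rfl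
        simp only [slots, update_slots_cur, update_slots_aux] at h₁
        refine ((ScanLoop.step (s := ⟨m, inp, slots (none :: T) O U (some l :: V) []⟩)
          (by simp [seen, more]) (RunsI.ite_true
          (p := fun m : Mem => decide (m.t = some (.inl .endClause))) rfl h₁)
          (ih { m with t := some (Item.tag none) } (none :: U) hm)).mono ?_).congr ?_
        · simp only [List.length_cons]
          omega
        · simp [delVar, List.filter_cons]
      | some l' =>
        have h₁ := runsI_compare (N := N) (ν := forgetSign) (a := .cur) (b := .found) (by simp)
          (fun m b => { m with hit := b })
          (s := seen .cur ⟨m, inp, slots (some l' :: T) O U (some l :: V) []⟩)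
          (it := some l') (it' := some l) rfl rfl
        simp only [compare_forgetSign_iff] at h₁
        by_cases h : l'.var = l.var
        · have h₂ := runsI_drop (N := N) (a := .cur) (s := ⟨{ m with
            t := some (Item.tag (some l'))
            hit := true }, inp, slots (some l' :: T) O U (some l :: V) []⟩)
          have h₃ := runsI_act (N := N) (s := ⟨{ m with
            t := some (Item.tag (some l'))
            hit := true }, inp, slots T O U (some l :: V) []⟩) (fun m => { m with hit := false })
          simp only [slots, update_slots_cur, List.tail_cons] at h₂
          rw [decide_eq_true h] at h₁
          refine ((ScanLoop.step (by simp [seen, more]) (RunsI.ite_false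
            (p := fun m => decide (m.t = some (.inl .endClause))) rfl
            (h₁.seq ((RunsI.ite_true (p := Mem.hit) rfl h₂).seq h₃)))
            (ih _ U rfl)).mono ?_).congr ?_
          · simp only [List.length_cons]
            omega
          · simp [delVar, h, hm]
        · have h₂ := runsI_move (N := N) (a := .cur) (b := .aux) (it := some l') (L := T)
            (s := ⟨{ m with
              t := some (Item.tag (some l'))
              hit := false }, inp, slots (some l' :: T) O U (some l :: V) []⟩) rfl
          have h₃ := runsI_act (N := N) (s := ⟨{ m with
            t := some (Item.tag (some l'))
            hit := false }, inp, slots T O (some l' :: U) (some l :: V) []⟩)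
            (fun m => { m with hit := false })
          simp only [slots, update_slots_cur, update_slots_aux] at h₂
          rw [decide_eq_false h] at h₁
          refine ((ScanLoop.step (by simp [seen, more]) (RunsI.ite_false
            (p := fun m => decide (m.t = some (.inl .endClause))) rfl
            (h₁.seq ((RunsI.ite_false (p := Mem.hit) rfl h₂).seq h₃)))
            (ih _ (some l' :: U) rfl)).mono ?_).congr ?_
          · simp only [List.length_cons]
            omega
          · simp [delVar, h, hm]
  refine (((key T m [] hm).runsI.seq (runsI_rewind (by simp) _)).mono ?_).congr ?_
  · have : (delVar l.var T).length ≤ T.length := List.length_filter_le _ _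
    simp
    omega
  · simp

/-- The number that is given by a symbol. -/
def symVal : Option Alpha → ℕ
  | some (.inr s) => s.val
  | _ => 0

/-- Delete the variable of the collected literal that is given by the current symbol. -/
def delete : Cmd (Stk Slot) Alpha (Regs Mem) :=
  ite (fun r => decide (1 ≤ symVal r.mem.sym)) (drop .found) skip ;;
    ite (fun r => decide (2 ≤ symVal r.mem.sym)) (drop .found) skip ;;
    see .found ;; ite (fun r => more r.mem) deleteVar skip

theorem runsI_ite_drop (k : ℕ) (m : Mem) (inp : List Alpha) (T O U V X : List Item) :
    RunsI N (ite (fun r => decide (k ≤ symVal r.mem.sym)) (drop .found) Cmd.skip)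
      ⟨m, inp, slots T O U V X⟩
      ⟨m, inp, slots T O U (if k ≤ symVal m.sym then V.tail else V) X⟩ 2 := by
  split_ifs with h
  · have h₁ := runsI_drop (N := N) (a := .found) (s := ⟨m, inp, slots T O U V X⟩)
    simp only [slots, update_slots_found] at h₁
    exact RunsI.ite_true (p := fun m : Mem => decide (k ≤ symVal m.sym)) (decide_eq_true h) h₁
  · exact RunsI.ite_false (p := fun m : Mem => decide (k ≤ symVal m.sym)) (decide_eq_false h)
      RunsI.skip

/-- For `s ≤ 2`, the two conditional drops remove exactly `s` literals, and dropping from an empty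
stack does nothing. An exhausted stack is then left alone, in agreement with `delNth`. -/
theorem runsI_delete (m : Mem) (hm : m.hit = false) (ht : m.t = none) (inp : List Alpha)
    (T O : List Item) (v : List Lit) (s : Fin 4) (hs : m.sym = some (.inr s)) (hs3 : s ≠ 3) :
    RunsI N delete ⟨m, inp, slots T O [] (v.map some) []⟩
      ⟨m, inp, slots (delNth s v T) O [] ((v.drop s).map some) []⟩ (10 * T.length + 10) := by
  have h₁ := runsI_ite_drop (N := N) 1 m inp T O [] (v.map some) []
  have h₂ := runsI_ite_drop (N := N) 2 m inp T O []
    (if 1 ≤ symVal m.sym then (v.map some).tail else v.map some) []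
  have hv : (if 2 ≤ symVal m.sym then
      (if 1 ≤ symVal m.sym then (v.map some).tail else v.map some).tail
      else if 1 ≤ symVal m.sym then (v.map some).tail else v.map some) = (v.drop s).map some := by
    rw [hs, List.map_drop]
    fin_cases s
    · rfl
    · simp [symVal]
    · cases v <;> simp [symVal]
    · exact absurd rfl hs3
  rw [hv] at h₂
  have h₃ := runsI_see (N := N) (a := .found) (s := ⟨m, inp, slots T O [] ((v.drop s).map some) []⟩)
  cases hd : v.drop s with
  | nil =>
    rw [hd] at h₂ h₃
    refine ((h₁.seq (h₂.seq (h₃.seq (RunsI.ite_false (p := more) rfl RunsI.skip)))).mono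
      (by omega)).congr ?_
    simp [seen, ← ht, delNth, hd]
  | cons l v' =>
    rw [hd] at h₂ h₃
    have h₄ := runsI_deleteVar (N := N) { m with t := some (Item.tag (some l)) } hm inp l T O
      (v'.map some)
    refine ((h₁.seq (h₂.seq (h₃.seq (RunsI.ite_true (p := more) rfl h₄)))).mono (by omega)).congr ?_
    simp [← ht, delNth, hd]

/-- Restore the original list. -/
def restore : Cmd (Stk Slot) Alpha (Regs Mem) :=
  empty .cur ;; scan more .orig (copy .orig .cur ;; move .orig .aux) ;; rewind .aux .orig

/-- The original list is stored in reverse, so copying it item by item onto `cur` puts it in order,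
while the originals return by way of `aux`. -/
theorem runsI_restore (m : Mem) (inp : List Alpha) (T O V : List Item) :
    RunsI N restore ⟨m, inp, slots T O [] V []⟩
      ⟨{ m with t := none }, inp, slots O.reverse O [] V []⟩ (3 * T.length + 7 * O.length + 6) := by
  have key : ∀ (O : List Item) (m : Mem) (T U : List Item),
      ScanLoop N more .orig (copy .orig .cur ;; move .orig .aux) ⟨m, inp, slots T O U V []⟩
        ⟨{ m with t := none }, inp, slots (O.reverse ++ T) [] (O.reverse ++ U) V []⟩
        (4 * O.length + 1) := by
    intro O
    induction O with
    | nil =>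
      intro m T U
      exact (ScanLoop.done (by simp [seen, more])).congr (by simp [seen])
    | cons it O ih =>
      intro m T U
      have h₁ := runsI_copy (N := N) (a := .orig) (b := .cur) (by simp) (it := it) (L := O)
        (s := seen .orig ⟨m, inp, slots T (it :: O) U V []⟩) rfl
      have h₂ := runsI_move (N := N) (a := .orig) (b := .aux) (it := it) (L := O)
        (s := ⟨{ m with t := some it.tag }, inp, slots (it :: T) (it :: O) U V []⟩) rfl
      simp only [seen, slots, update_slots_cur] at h₁
      simp only [slots, update_slots_orig, update_slots_aux] at h₂
      refine ((ScanLoop.step (by simp [seen, more]) (h₁.seq h₂)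
        (ih _ (it :: T) (it :: U))).mono ?_).congr ?_
      · simp only [List.length_cons]
        omega
      · simp
  have h₁ := runsI_empty (N := N) .cur ⟨m, inp, slots T O [] V []⟩
  simp only [slots, update_slots_cur] at h₁
  refine ((h₁.seq ((key O { m with t := none } [] []).runsI.seq
    (runsI_rewind (by simp) _))).mono ?_).congr ?_
  · simp
    omega
  · simp

/-- The memory between two rounds. -/
def calm (acc : Bool) (sym : Option Alpha) (aut : Option (Fin 4 × Loc)) : Mem :=
  ⟨none, false, false, acc, 0, sym, aut⟩

/-- One round of the search. -/
def round (wt : Bool → ℕ) (thr : ℕ) : Cmd (Stk Slot) Alpha (Regs Mem) :=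
  find wt thr ;;
    ite (fun r => r.mem.fnd)
      (ite (fun r => decide (r.mem.sym = some (.inr 3))) restore delete)
      (act fun m => { m with acc := true }) ;;
    empty .found ;; act fun m => calm m.acc m.sym m.aut

variable {wt : Bool → ℕ} {thr : ℕ}

/-- Each round discards the collected literals and resets the registers, so the next one starts from
a state of the same shape. -/
theorem runsI_round (hwt : ∀ b, wt b ≤ 2) (hthr : thr ≤ 3) (h₀ : 0 < thr) (inp : List Alpha)
    (aut : Option (Fin 4 × Loc)) (s : Fin 4) {K : ℕ} {T O : List Item} (hT : T.length ≤ K)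
    (hO : O.length ≤ K) :
    RunsI N (round wt thr) ⟨calm false (some (.inr s)) aut, inp, slots T O [] [] []⟩
      ⟨calm (findBad wt thr [] T).isNone (some (.inr s)) aut, inp,
        slots ((findBad wt thr [] T).elim T fun v =>
          if s = 3 then O.reverse else delNth s v T) O [] [] []⟩ (K * (7 * K + 35) + 30) := by
  obtain ⟨w, v, hv, hvf, h₁⟩ := exists_runsI_find (N := N) hwt hthr h₀ inp O T
    (m := calm false (some (.inr s)) aut) rfl rfl rfl
  have hle : T.length * (7 * T.length + 18) ≤ K * (7 * K + 18) :=
    Nat.mul_le_mul hT (by omega)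
  have hK : K * (7 * K + 35) = K * (7 * K + 18) + 17 * K := by ring
  cases hf : findBad wt thr [] T with
  | none =>
    rw [hf] at h₁
    have h₂ := runsI_act (N := N) (s := ⟨{ calm false (some (.inr s)) aut with
      t := none
      w := w
      fnd := false }, inp, slots T O [] (v.map some) []⟩) (fun m => { m with acc := true })
    have h₃ := runsI_empty (N := N) .found ⟨{ calm true (some (.inr s)) aut with w := w }, inp,
      slots T O [] (v.map some) []⟩
    refine ((h₁.seq ((RunsI.ite_false (p := Mem.fnd) rfl h₂).seq
      (h₃.seq (runsI_act fun m => calm m.acc m.sym m.aut)))).mono ?_).congr ?_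
    · simp
      omega
    · simp [calm]
  | some v' =>
    obtain rfl := hvf v' hf
    rw [hf] at h₁
    by_cases hs : s = 3
    · subst hs
      have h₂ := runsI_restore (N := N) { calm false (some (.inr 3)) aut with
        t := none
        w := w
        fnd := true } inp T O (v.map some)
      have h₃ := runsI_empty (N := N) .found ⟨{ calm false (some (.inr 3)) aut with
        w := w
        fnd := true }, inp, slots O.reverse O [] (v.map some) []⟩
      refine ((h₁.seq ((RunsI.ite_true (p := Mem.fnd) rfl (RunsI.ite_true
        (p := fun m : Mem => decide (m.sym = some (.inr 3))) rfl h₂)).seq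
        (h₃.seq (runsI_act fun m => calm m.acc m.sym m.aut)))).mono ?_).congr ?_
      · simp
        omega
      · simp [calm]
    · have h₂ := runsI_delete (N := N) { calm false (some (.inr s)) aut with
        t := none
        w := w
        fnd := true } rfl rfl inp T O v s rfl hs
      have h₃ := runsI_empty (N := N) .found ⟨{ calm false (some (.inr s)) aut with
        t := none
        w := w
        fnd := true }, inp, slots (delNth s v T) O [] ((v.drop s).map some) []⟩
      refine ((h₁.seq ((RunsI.ite_true (p := Mem.fnd) rfl (RunsI.ite_false
        (p := fun m : Mem => decide (m.sym = some (.inr 3))) (by simpa [calm] using hs) h₂)).seq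
        (h₃.seq (runsI_act fun m => calm m.acc m.sym m.aut)))).mono ?_).congr ?_
      · simp
        omega
      · simp [calm, hs]

/-- The search. -/
def main (wt : Bool → ℕ) (thr : ℕ) : Cmd (Stk Slot) Alpha (Regs Mem) :=
  loop (fun r => r.mem.sym.isSome && !r.mem.acc)
    (round wt thr ;; popInp fun m o => { m with sym := o })

theorem length_delNth_le (s : ℕ) (v : List Lit) (T : List Item) :
    (delNth s v T).length ≤ T.length := by
  unfold delNth
  cases (v.drop s).head? with
  | none => exact le_rfl
  | some l => exact List.length_filter_le _ _

theorem RunsI.congr_left {c : Cmd (Stk Slot) Alpha (Regs Mem)} {s s' t : ItemState Mem Slot} {n : ℕ}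
    (hs : s = s') (h : RunsI N c s t n) : RunsI N c s' t n := hs ▸ h

/-- The loop stops as soon as it accepts, hence the unspecified rest of the input and of the current
list. Deletions only shrink the list and a restart returns to `O`, so `K` bounds all rounds. -/
theorem exists_runsI_main (hwt : ∀ b, wt b ≤ 2) (hthr : thr ≤ 3) (h₀ : 0 < thr)
    (aut : Option (Fin 4 × Loc)) {K : ℕ} {O : List Item} (hO : O.length ≤ K) (w : List (Fin 4)) :
    ∀ T : List Item, T.length ≤ K → ∃ (sym : Option Alpha) (inp : List Alpha) (T' : List Item),
      RunsI N (main wt thr)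
        ⟨calm false (w.head?.map .inr) aut, w.tail.map .inr, slots T O [] [] []⟩
        ⟨calm (search wt thr O.reverse T w) sym aut, inp, slots T' O [] [] []⟩
        (w.length * (K * (7 * K + 35) + 32) + 1) := by
  induction w with
  | nil =>
    intro T hT
    exact ⟨none, [], T, (RunsI.loop_done (p := fun m : Mem => m.sym.isSome && !m.acc) rfl).mono
      (by simp)⟩
  | cons s w ih =>
    intro T hT
    have h₁ := runsI_round (N := N) hwt hthr h₀ (w.map .inr) aut s hT hO
    cases hf : findBad wt thr [] T with
    | none =>
      rw [hf] at h₁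
      have h₂ := runsI_popInp (N := N) (s := ⟨calm true (some (.inr s)) aut, w.map .inr,
        slots T O [] [] []⟩) (fun m o => { m with sym := o })
      refine ⟨(w.map .inr).head?, (w.map .inr).tail, T, ((RunsI.loop_step
        (p := fun m : Mem => m.sym.isSome && !m.acc) rfl (h₁.seq h₂)
        (RunsI.loop_done (p := fun m : Mem => m.sym.isSome && !m.acc) (by simp [calm]))).mono ?_).congr ?_⟩
      · simp only [List.length_cons, add_mul]
        omega
      · simp [search, hf, calm]
    | some v =>
      rw [hf] at h₁
      obtain ⟨sym, inp, T', h₂⟩ := ih (if s = 3 then O.reverse else delNth s v T) (by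
        split_ifs
        · simpa using hO
        · exact (length_delNth_le _ _ _).trans hT)
      have h₃ := runsI_popInp (N := N) (s := ⟨calm false (some (.inr s)) aut, w.map .inr,
        slots (if s = 3 then O.reverse else delNth s v T) O [] [] []⟩)
        (fun m o => { m with sym := o })
      refine ⟨sym, inp, T', ((RunsI.loop_step (p := fun m : Mem => m.sym.isSome && !m.acc) rfl
        (h₁.seq h₃) (RunsI.congr_left ?_ h₂)).mono ?_).congr ?_⟩
      · simp [calm]
      · simp only [List.length_cons, add_mul]
        omega
      · simp only [search, hf, Option.elim_some]
        split_ifs <;> rfl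

end Cmd

namespace Cmd

/-! ### Reading the input, and erasing the stacks -/

/-- Store a symbol that was read in the memory. -/
def setSym (m : Mem) (o : Option Alpha) : Mem := { m with sym := o }

/-- Let the automaton read the current symbol. -/
def advance (m : Mem) : Mem :=
  match m.sym with
  | some (.inl g) => { m with aut := autStep m.aut g }
  | _ => m

/-- The current symbol belongs to the word of a theory. -/
def isTheorySym (m : Mem) : Bool := m.sym.elim false Sum.isLeft

/-- The current symbol belongs to the word of a clause. -/
def isStored (m : Mem) : Bool :=
  m.sym.elim false fun g => g.elim isClauseSym fun _ => false

/-- The loop that reads the word of a theory, runs the automaton on it and stores the clauses. -/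
def readLoop : Cmd (Stk Slot) Alpha (Regs Mem) :=
  loop (fun r => isTheorySym r.mem)
    (act advance ;;
      ite (fun r => isStored r.mem) (push (.item .orig) fun r => r.mem.sym.getD (.inr 0)) skip ;;
      popInp setSym)

/-- The contents of the stacks while the input is read. -/
def readStk (inp L : List Alpha) : Stk Slot → List Alpha
  | .inp => inp
  | .item .orig => L
  | _ => []

@[simp] theorem update_readStk_inp (inp L L' : List Alpha) :
    update (readStk inp L) .inp L' = readStk L' L := by
  funext k
  rcases k with _ | _ | _ | (_ | _ | _ | _ | _) <;> simp [readStk]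

@[simp] theorem update_readStk_orig (inp L L' : List Alpha) :
    update (readStk inp L) (.item .orig) L' = readStk inp L' := by
  funext k
  rcases k with _ | _ | _ | (_ | _ | _ | _ | _) <;> simp [readStk]

/-- The internal state between two operations. -/
def idle {M : Type} (m : M) : Regs M := ⟨none, none, false, false, m⟩

/-- The machine reads one symbol ahead: the head of the remaining word is in the memory, its tail on
the stack. When the theory is exhausted, the first symbol of the guide is already where `main`
expects it. -/
theorem runs_readLoop (w : List (Fin 4)) (x : List Sym) : ∀ (m : Mem) (L : List Alpha),
    m.sym = (x.map .inl ++ w.map .inr : List Alpha).head? →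
    Runs readLoop (idle m, readStk (x.map .inl ++ w.map .inr : List Alpha).tail L)
      (idle { m with sym := w.head?.map .inr, aut := x.foldl autStep m.aut },
        readStk (w.tail.map .inr) (((x.filter isClauseSym).map .inl).reverse ++ L))
      (5 * x.length + 1) := by
  induction x with
  | nil =>
    intro m L hm
    have h : isTheorySym m = false := by
      rw [isTheorySym, hm]
      cases w <;> rfl
    refine (Runs.loop_done (s := (idle m, _)) h).congr ?_ (by simp)
    obtain ⟨t, hit, fnd, acc, w', sym, aut⟩ := m
    simp only [List.map_nil, List.nil_append, List.head?_map] at hm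
    simp [hm]
  | cons g x ih =>
    intro m L hm
    have hm' : m.sym = some (.inl g) := hm
    have h₁ : advance m = { m with aut := autStep m.aut g } := by simp [advance, hm']
    have h₂ := ih { m with
      sym := (x.map .inl ++ w.map .inr : List Alpha).head?
      aut := autStep m.aut g } (if isClauseSym g then .inl g :: L else L) rfl
    have h₃ : Runs (ite (fun r => isStored r.mem)
        (push (.item .orig) fun r => r.mem.sym.getD (.inr 0)) Cmd.skip)
        (idle { m with aut := autStep m.aut g }, readStk (x.map .inl ++ w.map .inr) L)
        (idle { m with aut := autStep m.aut g }, readStk (x.map .inl ++ w.map .inr)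
          (if isClauseSym g then .inl g :: L else L)) 2 := by
      split_ifs with hg
      · refine (Runs.ite_true (s := (idle _, _)) ?_ Runs.push).congr ?_ rfl
        · simpa [idle, isStored, hm'] using hg
        · simp [idle, hm', readStk]
      · refine (Runs.ite_false (s := (idle _, _)) ?_ Runs.skip).congr rfl rfl
        simpa [idle, isStored, hm'] using hg
    have h₄ := Runs.seq (Runs.load (f := fun r : Regs Mem => { r with mem := advance r.mem })
      (v := idle m) (S := readStk (x.map .inl ++ w.map .inr) L))
      (Runs.seq (h₃.congr_left (by simp [idle, h₁]))
        (Runs.pop (k := .inp) (f := fun r o => { r with mem := setSym r.mem o })))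
    refine (Runs.loop_step (s := (idle m, _)) (by simp [idle, isTheorySym, hm']) h₄
      (h₂.congr_left ?_)).congr ?_ ?_
    · simp [idle, setSym, readStk]
    · simp [List.filter_cons]
      split_ifs <;> simp
    · simp
      omega

/-- Read the word of a theory, and the first symbol of the rest of the input. -/
def readInput : Cmd (Stk Slot) Alpha (Regs Mem) := popInp setSym ;; readLoop

theorem runs_readInput (x : List Sym) (w : List (Fin 4)) :
    Runs readInput (idle (calm false none (some (0, .first))),
      readStk (x.map .inl ++ w.map .inr) [])
      (idle (calm false (w.head?.map .inr) (x.foldl autStep (some (0, .first)))),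
        readStk (w.tail.map .inr) ((x.filter isClauseSym).map .inl).reverse)
      (5 * x.length + 2) :=
  (Runs.seq Runs.pop ((runs_readLoop w x (calm false (x.map .inl ++ w.map .inr : List Alpha).head?
    (some (0, .first))) [] rfl).congr_left (by simp [idle, calm, setSym, readStk]))).congr
    (by simp [calm]) (by omega)

/-- Empty all the stacks of a list. -/
def clearList {M I : Type} : List (Stk I) → Cmd (Stk I) Alpha (Regs M)
  | [] => skip
  | k :: ks => clear k ;; clearList ks

theorem exists_runsLe_clearList {M I : Type} [DecidableEq I] (ks : List (Stk I)) (b : ℕ) :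
    ∀ (r : Regs M) (S : Stk I → List Alpha), (∀ k, (S k).length ≤ b) → ∃ r' : Regs M,
      r'.mem = r.mem ∧ RunsLe (clearList ks) (r, S) (r', fun k => if k ∈ ks then [] else S k)
        (ks.length * (4 * b + 6) + 1) := by
  induction ks with
  | nil => exact fun r S h => ⟨r, rfl, Runs.le Runs.skip (by simp) (by simp)⟩
  | cons k ks ih =>
    intro r S h
    obtain ⟨r', hr, n, hn, h₁⟩ := ih { r with x := none, go := false } (update S k []) (fun k' => by
      rw [update_apply]
      split_ifs
      · simp
      · exact h k')
    refine ⟨r', hr, Runs.le ((runs_clear k r S).seq h₁) ?_ ?_⟩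
    · simp only [Prod.mk.injEq, true_and]
      funext k'
      simp only [List.mem_cons, update_apply]
      split_ifs <;> simp_all
    · have := h k
      rw [List.length_cons, add_mul]
      omega

/-- The list of all stacks. -/
def allStk : List (Stk Slot) :=
  [.inp, .tA, .tB, .item .cur, .item .orig, .item .aux, .item .found, .item .aux']

theorem mem_allStk (k : Stk Slot) : k ∈ allStk := by
  rcases k with _ | _ | _ | (_ | _ | _ | _ | _) <;> simp [allStk]

/-! ### The whole program -/

/-- The program that decides whether the guided search succeeds. -/
def program (wt : Bool → ℕ) (thr : ℕ) : Cmd (Stk Slot) Alpha (Regs Mem) :=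
  (readInput ;; ite (fun r => decide (r.mem.aut = some (1, .first)))
    (restore ;; main wt thr) skip) ;; clearList allStk

/-- The guided search succeeds. -/
def accepts (wt : Bool → ℕ) (thr : ℕ) (p : List Sym × List (Fin 4)) : Bool :=
  decide (p.1.foldl autStep (some (0, .first)) = some (1, .first)) &&
    search wt thr (parse p.1).2 (parse p.1).2 p.2

theorem length_le_length_codes (L : List Item) : L.length ≤ (Item.codes L).length := by
  induction L with
  | nil => simp
  | cons it L ih =>
    rw [Item.codes_cons]
    simp
    omega

theorem length_body_le_length_codes {L : List Item} {it : Item} (h : it ∈ L) :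
    it.body.length ≤ (Item.codes L).length := by
  induction L with
  | nil => simp at h
  | cons it' L ih =>
    rw [Item.codes_cons]
    rcases List.mem_cons.1 h with rfl | h
    · simp
    · have := ih h
      simp
      omega

/-- A bound for the time of the search. -/
def searchTime (n : ℕ) : ℕ :=
  5 * n + 4 + (7 * n + 6 + (n * (n * (7 * n + 35) + 32) + 1)) * (30 * (n + 2))

/-- If the automaton accepts, the stored symbols are codes of items and `restore` on an empty `cur`
produces the initial list. Otherwise they need not code anything, and the search is skipped with
`acc` still false. -/
theorem exists_runsLe_search {wt : Bool → ℕ} {thr : ℕ} (hwt : ∀ b, wt b ≤ 2) (hthr : thr ≤ 3)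
    (h₀ : 0 < thr) (x : List Sym) (w : List (Fin 4)) {n : ℕ} (hn : x.length + w.length = n) :
    ∃ s : Regs Mem × (Stk Slot → List Alpha), s.1.mem.acc = accepts wt thr (x, w) ∧
      RunsLe (readInput ;; ite (fun r => decide (r.mem.aut = some (1, .first)))
        (restore ;; main wt thr) Cmd.skip) (idle (calm false none (some (0, .first))),
        readStk (x.map .inl ++ w.map .inr) []) s (searchTime n) := by
  have h₁ := runs_readInput x w
  by_cases h : x.foldl autStep (some (0, .first)) = some (1, .first)
  · obtain ⟨c, rfl⟩ := (foldl_autStep_iff x).1 h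
    set O := (itemsOf c.clauseList).reverse with hO
    have hc : ((c.word.filter isClauseSym).map Sum.inl).reverse = Item.codes O := by
      rw [hO, codes_reverse_itemsOf, c.filter_word]
    have hl : (Item.codes O).length ≤ n := by
      rw [← hc, List.length_reverse, List.length_map]
      have := List.length_filter_le isClauseSym c.word
      omega
    have hOn : O.length ≤ n := (length_le_length_codes O).trans hl
    obtain ⟨sym, inp, T', h₂⟩ := exists_runsI_main (N := n) hwt hthr h₀ (some (1, .first)) hOn w
      O.reverse (by simpa using hOn)
    have h₃ := runsI_restore (N := n) (calm false (w.head?.map .inr) (some (1, .first)))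
      (w.tail.map .inr) [] O []
    -- Names are parts of the input, so `n` bounds their length as well as the number of items.
    obtain ⟨-, m, hm, h₄⟩ := (h₃.seq h₂) (by
      rintro (_ | _ | _ | _ | _) it hi
      all_goals first | exact (length_body_le_length_codes hi).trans hl | simp at hi)
    rw [h, hc] at h₁
    refine ⟨_, ?_, Runs.le (h₁.seq (Runs.ite_true (by simp [idle, calm])
      (h₄.congr_left ?_))) rfl ?_⟩
    · rw [accepts, h, c.parse_word]
      simp [ItemState.enc, calm, hO]
    · refine Prod.ext rfl ?_
      funext k
      rcases k with _ | _ | _ | (_ | _ | _ | _ | _) <;> rfl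
    · have hw : w.length * (n * (7 * n + 35) + 32) ≤ n * (n * (7 * n + 35) + 32) :=
        Nat.mul_le_mul_right _ (by omega)
      have := hm.trans (Nat.mul_le_mul_right (30 * (n + 2)) (show 3 * ([] : List Item).length +
        7 * O.length + 6 + (w.length * (n * (7 * n + 35) + 32) + 1) ≤
          7 * n + 6 + (n * (n * (7 * n + 35) + 32) + 1) by simp; omega))
      rw [searchTime]
      omega
  · refine ⟨_, ?_, Runs.le (h₁.seq (Runs.ite_false (decide_eq_false h) Runs.skip)) rfl
      ?_⟩
    · simp [accepts, h, idle, calm]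
    · rw [searchTime]
      omega

end Cmd

open Cmd Computability

theorem inP_accepts {wt : Bool → ℕ} {thr : ℕ} (hwt : ∀ b, wt b ≤ 2) (hthr : thr ≤ 3)
    (h₀ : 0 < thr) : InP (encodingProd (encodingList Sym) (encodingList (Fin 4)))
      {p | accepts wt thr p = true} := by
  -- This is `searchTime` as a polynomial; erasing the eight stacks is added to it below.
  let t : Polynomial ℕ := 5 * .X + 4 + (7 * .X + 6 + (.X * (.X * (7 * .X + 35) + 32) + 1)) *
    (30 * (.X + 2))
  refine inP_of_runsLe _ _ (program wt thr) .inp (idle (calm false none (some (0, .first))))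
    (fun r => r.mem.acc) (t + (8 * (4 * (.X + t) + 6) + 1)) fun ⟨x, w⟩ => ?_
  have he : (encodingProd (encodingList Sym) (encodingList (Fin 4))).encode (x, w) =
      x.map .inl ++ w.map .inr := rfl
  have hu : update (fun _ => []) Stk.inp (x.map .inl ++ w.map .inr) =
      readStk (x.map .inl ++ w.map .inr) [] := by
    funext k
    rcases k with _ | _ | _ | (_ | _ | _ | _ | _) <;> rfl
  rw [he, hu]
  set n := (x.map Sum.inl ++ w.map Sum.inr : List Alpha).length with hn
  have ht : t.eval n = searchTime n := by simp [t, searchTime]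
  obtain ⟨⟨r, S⟩, hacc, m, hm, h₁⟩ := exists_runsLe_search hwt hthr h₀ x w (n := n) (by simp [hn])
  -- No stack is longer than the input plus the number of steps made.
  obtain ⟨r', hr, k, hk, h₂⟩ := exists_runsLe_clearList allStk (n + searchTime n) r S (fun k => by
    refine (h₁.length_le k).trans (Nat.add_le_add ?_ hm)
    rcases k with _ | _ | _ | (_ | _ | _ | _ | _) <;> simp [readStk, hn])
  refine ⟨r', Runs.le (h₁.seq h₂) (by simp [mem_allStk]) ?_, by rw [hr, hacc]⟩
  simp [ht, allStk] at hk ⊢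
  omega

/-- Both problems reject words that are not words of theories. For any `c` with the given word,
parsing recovers the clause list of `c`, so the same `c` serves in both directions. -/
theorem fpt_backdoorDetection {wt : Bool → ℕ} {thr : ℕ} {Θ : Set CNF} (h : IsWeighting wt thr Θ) :
    FPT (BackdoorDetection Θ) := by
  refine ⟨4, guide, {p | accepts wt thr p = true}, computable_guide,
    inP_accepts h.1 h.2.1 (by have := h.2.2.1; omega), fun x k => ?_⟩
  simp only [BackdoorDetection, Set.mem_ofPred_eq, accepts, Bool.and_eq_true, decide_eq_true_eq,
    foldl_autStep_iff]
  constructor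
  · rintro ⟨c, rfl, hB⟩
    rw [h.exists_backdoor_iff] at hB
    exact ⟨⟨c, rfl⟩, by rwa [c.parse_word]⟩
  · rintro ⟨⟨c, rfl⟩, hs⟩
    refine ⟨c, rfl, ?_⟩
    rwa [h.exists_backdoor_iff, ← c.parse_word]

end DefaultLogic

theorem mainTheorem2 :
    (∀ Θ ∈ ({DefaultLogic.Horn, DefaultLogic.PosUnit, DefaultLogic.Krom,
        DefaultLogic.Monotone} : Set (Set DefaultLogic.CNF)),
      DefaultLogic.FPT (DefaultLogic.BackdoorDetection Θ)) ∧
    ∀ (T : DefaultLogic.DefaultTheory) (B : Finset DefaultLogic.Var), B ⊆ T.vars →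
      (DefaultLogic.IsStrongBackdoor DefaultLogic.Horn T B ↔
        (DefaultLogic.hornGraph T).IsVertexCover (B : Set DefaultLogic.Var)) ∧
      (DefaultLogic.IsStrongBackdoor DefaultLogic.PosUnit T B ↔
        (DefaultLogic.primalGraph T).IsVertexCover (B : Set DefaultLogic.Var) ∧
          DefaultLogic.negVars T ⊆ (B : Set DefaultLogic.Var)) ∧
      (T.TautologyFree →
        (DefaultLogic.IsStrongBackdoor DefaultLogic.Krom T B ↔
          DefaultLogic.IsHittingSet (DefaultLogic.kromHypergraph T) B)) ∧
      (DefaultLogic.IsStrongBackdoor DefaultLogic.Monotone T B ↔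
        DefaultLogic.negVars T ⊆ (B : Set DefaultLogic.Var)) := by
  refine ⟨fun Θ hΘ => ?_, fun T B hB => ⟨DefaultLogic.isStrongBackdoor_horn_iff T B hB,
    DefaultLogic.isStrongBackdoor_posUnit_iff T B hB,
    fun hT => DefaultLogic.isStrongBackdoor_krom_iff T B hB hT,
    DefaultLogic.isStrongBackdoor_monotone_iff T B hB⟩⟩
  obtain ⟨wt, thr, h⟩ := DefaultLogic.exists_isWeighting hΘ
  exact DefaultLogic.fpt_backdoorDetection h
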